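/- A $C$-relation on a set $M$ is a ternary relation $C$ such that, for all $x,y,z,w$: (1) $C(x,y,z)\to C(x,z,y)$; (2) $C(x,y,z)\to\neg C(y,x,z)$; (3) $C(x,y,z)\to[C(x,y,w)\vee C(w,y,z)]$; (4) $x\neq y\to C(x,y,y)$. A $C$-structure is a first-order structure in a countable language containing a ternary symbol $C$ that is interpreted by a $C$-relation. Its canonical tree $T$ is the quotient of $M^2$, ordered by the relation induced by the preorder $$(\alpha,\beta)\preccurlyeq(\gamma,\delta)\iff \neg C(\gamma,\alpha,\beta)\ \&\ \neg C(\delta,\alpha,\beta),$$ by the associated equivalence relation; it is a meet semi-lattice, considered as a structure in the language $\{<,\wedge,L\}$, where $L$ is the set of leaves (maximal elements). For a leaf $\alpha$ the branch $br(\alpha)=\{t\in T: t\le\alpha\}$ is a chain. An interval of $br(\alpha)$ is always meant with bounds in $br(\alpha)\cup\{-\infty\}$. A basic interval of $br(\alpha)$ is a singleton or a nonempty densely ordered interval of $br(\alpha)$. It is one-typed if all its elements have the same complete $1$-type over $\emptyset$ in $T$. **Theorem.** Let $M$ be a finite or countable $C$-structure with at least two elements which is $\aleph_0$-categorical (its complete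 theory has, up to isomorphism, at most one model of cardinality $\aleph_0$) and indiscernible (all elements of $M$ have the same complete $1$-type over $\emptyset$). Let $T$ be its canonical tree. Assume that for each leaf $\alpha$ of $T$, any subset of $br(\alpha)$ definable in $T$ with parameters is a finite union of intervals of $br(\alpha)$. Then there is an integer $n\ge 1$ such that, for any leaf $\alpha$ of $T$, the branch of $\alpha$ is a disjoint union $$br(\alpha)=I_1(\alpha)\cup\dots\cup I_n(\alpha)\cup\{\alpha\},\qquad I_1(\alpha)<\dots<I_n(\alpha),$$ where the $I_j(\alpha)$ are basic one-typed intervals of $br(\alpha)$ which are maximal, in the sense that no $I_j(\alpha)\cup I_{j+1}(\alpha)$ is a basic one-typed interval. This decomposition is unique: any decomposition of $br(\alpha)$ of this kind, with any number $m$ of intervals, has $m=n$ and the same intervals. Each $I_j(\alpha)$ has one of the forms $\{x\}$, $]x,y[$ (without greatest or least element), $]x,y]$ (without least element), where $x$ may be $-\infty$ in the last two. For each $j$, the form of $I_j(\alpha)$ and the type in $T$ of its elements do not depend on the leaf $\alpha$. The same holds when $T$ is considered, in the hypothesis on definable subsets and in the definition of types, with the full structure induced by $M$ (all relations on $T$ that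 are $\emptyset$-definable in $M$) instead of $\{<,\wedge,L\}$. -/

import Mathlib

open FirstOrder

/-! ### `C`-relations and the canonical tree -/

/-- The axioms of a `C`-relation. -/
structure IsCRelation {M : Type*} (C : M → M → M → Prop) : Prop where
  symm : ∀ x y z, C x y z → C x z y
  asymm : ∀ x y z, C x y z → ¬ C y x z
  trans : ∀ x y z w, C x y z → C x y w ∨ C w y z
  nontriv : ∀ x y, x ≠ y → C x y y

/-- The preorder on `M²`: `(α, β) ≼ (γ, δ)` iff `¬ C(γ, α, β)` and `¬ C(δ, α, β)`. -/
@[reducible] def IsCRelation.pairPreorder {M : Type*} {C : M → M → M → Prop}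
    (h : IsCRelation C) : Preorder (M × M) where
  le p q := ¬ C q.1 p.1 p.2 ∧ ¬ C q.2 p.1 p.2
  le_refl p := by
    obtain ⟨a, b⟩ := p
    exact ⟨fun H => h.asymm _ _ _ H H,
      fun H => h.asymm _ _ _ (h.symm _ _ _ H) (h.symm _ _ _ H)⟩
  le_trans p q r hpq hqr := by
    obtain ⟨a, b⟩ := p
    obtain ⟨c, d⟩ := q
    obtain ⟨e, f⟩ := r
    have key : ∀ e, ¬ C c a b → ¬ C d a b → ¬ C e c d → ¬ C e a b := by
      intro e h1 h2 h3 H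
      have hc : C e a c := (h.trans _ _ _ c H).resolve_right h1
      have hd : C e a d := (h.trans _ _ _ d H).resolve_right h2
      rcases h.trans _ _ _ c (h.symm _ _ _ hd) with H1 | H1
      · exact h3 (h.symm _ _ _ H1)
      · rcases h.trans _ _ _ d (h.symm _ _ _ hc) with H2 | H2
        · exact h3 H2
        · exact h.asymm _ _ _ H1 H2
    exact ⟨key e hpq.1 hpq.2 hqr.1, key f hpq.1 hpq.2 hqr.2⟩

/-- The canonical tree `T(M) = M² / R` of a `C`-set, where `R` is the equivalence relation of the
preorder `≼`. -/
def CanonicalTree {M : Type*} {C : M → M → M → Prop} (h : IsCRelation C) : Type _ :=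
  @Antisymmetrization (M × M) h.pairPreorder.le inferInstance

namespace CanonicalTree

variable {M : Type*} {C : M → M → M → Prop} {h : IsCRelation C}

/-- The order of the canonical tree, induced by `≼`. -/
instance instPartialOrder : PartialOrder (CanonicalTree h) :=
  @instPartialOrderAntisymmetrization (M × M) h.pairPreorder

/-- The class `α ∧ β` of the pair `(α, β)`. -/
def mk (h : IsCRelation C) (a b : M) : CanonicalTree h :=
  @toAntisymmetrization (M × M) h.pairPreorder.le inferInstance (a, b)

theorem mk_le_mk {a b c d : M} : mk h a b ≤ mk h c d ↔ ¬ C c a b ∧ ¬ C d a b := Iff.rfl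

theorem exists_mk (x : CanonicalTree h) : ∃ a b, x = mk h a b := by
  induction x using Quotient.inductionOn with
  | _ p => exact ⟨p.1, p.2, rfl⟩

theorem exists_isGLB (x y : CanonicalTree h) : ∃ z, IsGLB {x, y} z := by
  obtain ⟨a, b, rfl⟩ := exists_mk x
  obtain ⟨c, d, rfl⟩ := exists_mk y
  by_cases hxy : mk h a b ≤ mk h c d
  · exact ⟨mk h a b, by
      refine ⟨?_, fun w hw => hw (by simp)⟩
      rintro z (rfl | rfl)
      exacts [le_rfl, hxy]⟩
  by_cases hyx : mk h c d ≤ mk h a b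
  · exact ⟨mk h c d, by
      refine ⟨?_, fun w hw => hw (by simp)⟩
      rintro z (rfl | rfl)
      exacts [hyx, le_rfl]⟩
  refine ⟨mk h a c, ?_, ?_⟩
  · have hs := h.symm
    have ha := h.asymm
    have ht := h.trans
    rw [mk_le_mk] at hxy hyx
    rintro z (rfl | rfl)
    · rw [mk_le_mk]
      grind
    · rw [mk_le_mk]
      grind
  · intro w hw
    obtain ⟨e, f, rfl⟩ := exists_mk w
    have h1 : mk h e f ≤ mk h a b := hw (by simp)
    have h2 : mk h e f ≤ mk h c d := hw (by simp)
    rw [mk_le_mk] at *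
    exact ⟨h1.1, h2.1⟩

/-- The meet of two elements of the canonical tree. -/
noncomputable def meet (x y : CanonicalTree h) : CanonicalTree h :=
  Classical.choose (exists_isGLB x y)

theorem isGLB_meet (x y : CanonicalTree h) : IsGLB {x, y} (meet x y) :=
  Classical.choose_spec (exists_isGLB x y)

end CanonicalTree

/-! ### Two structures on the canonical tree -/

/-- Function symbols of the language of good trees: the meet. -/
inductive TreeFunctions : ℕ → Type
  | meet : TreeFunctions 2

/-- Relation symbols of the language of good trees: the strict order and the set of leaves. -/
inductive TreeRelations : ℕ → Type
  | lt : TreeRelations 2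
  | leaf : TreeRelations 1

/-- The language `{<, ∧, L}` of good trees. -/
def treeLanguage : Language := ⟨TreeFunctions, TreeRelations⟩

/-- The canonical tree as a structure in the language `{<, ∧, L}`. -/
noncomputable instance CanonicalTree.treeStructure {M : Type*} {C : M → M → M → Prop}
    {h : IsCRelation C} : treeLanguage.Structure (CanonicalTree h) where
  funMap := fun f v => match f, v with
    | TreeFunctions.meet, v => CanonicalTree.meet (v 0) (v 1)
  RelMap := fun r v => match r, v with
    | TreeRelations.lt, v => v 0 < v 1
    | TreeRelations.leaf, v => IsMax (v 0)

/-- A set of `k`-tuples of the canonical tree is `∅`-definable in the structure `M` when its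
preimage in `(M²)ᵏ` is. -/
def CanonicalTree.DefinableIn (L : Language) {M : Type*} [L.Structure M] {C : M → M → M → Prop}
    (h : IsCRelation C) {k : ℕ} (S : Set (Fin k → CanonicalTree h)) : Prop :=
  (∅ : Set M).Definable L
    {v : Fin k × Fin 2 → M | (fun i => CanonicalTree.mk h (v (i, 0)) (v (i, 1))) ∈ S}

/-- The language of the structure induced by `M` on its canonical tree: one relation symbol for
each `∅`-definable relation. -/
def inducedLanguage (L : Language) {M : Type*} [L.Structure M] {C : M → M → M → Prop}
    (h : IsCRelation C) : Language :=
  ⟨fun _ => Empty, fun k => {S : Set (Fin k → CanonicalTree h) // CanonicalTree.DefinableIn L h S}⟩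

/-- The structure induced by `M` on its canonical tree. -/
instance CanonicalTree.inducedStructure (L : Language) {M : Type*} [L.Structure M]
    {C : M → M → M → Prop} (h : IsCRelation C) :
    (inducedLanguage L h).Structure (CanonicalTree h) where
  funMap := fun f => Empty.elim f
  RelMap := fun S v => v ∈ S.1

/-! ### Types, indiscernibility -/

/-- Two elements of a structure have the same complete `1`-type over `∅`. -/
def SameType (L : Language) {N : Type*} [L.Structure N] (a b : N) : Prop :=
  ∀ φ : L.Formula (Fin 1), φ.Realize (fun _ => a) ↔ φ.Realize (fun _ => b)

/-- All elements of the structure have the same complete `1`-type over `∅`. -/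
def Indiscernible (L : Language) (M : Type*) [L.Structure M] : Prop :=
  ∀ a b : M, SameType L a b

/-! ### Intervals of branches

The branch of a leaf `α` is `Set.Iic α`. In all definitions below, `α` is meant to be a leaf, and
the language `L` is the one in which definability and types in the tree are understood. -/

section Intervals

variable {T : Type*} [PartialOrder T]

/-- `I` is an interval of the branch of `α` with bounds in `br(α) ∪ {-∞}`. -/
def IsBranchInterval (α : T) (I : Set T) : Prop :=
  (∃ a ≤ α, ∃ b ≤ α,
    I = Set.Icc a b ∨ I = Set.Ico a b ∨ I = Set.Ioc a b ∨ I = Set.Ioo a b) ∨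
  ∃ b ≤ α, I = Set.Iic b ∨ I = Set.Iio b

/-- A basic interval of the branch of `α`: a singleton, or a (nonempty) densely ordered interval
with bounds in `br(α) ∪ {-∞}`. -/
def IsBasicInterval (α : T) (I : Set T) : Prop :=
  (∃ x ≤ α, I = {x}) ∨
  (I.Nonempty ∧ IsBranchInterval α I ∧ ∀ x ∈ I, ∀ y ∈ I, x < y → ∃ z ∈ I, x < z ∧ z < y)

/-- A basic one-typed interval of the branch of `α`. -/
def IsBasicOneTyped (L : Language) [L.Structure T] (α : T) (I : Set T) : Prop :=
  IsBasicInterval α I ∧ ∀ x ∈ I, ∀ y ∈ I, SameType L x y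

/-- Every subset of a branch `br(α)`, `α` a leaf, that is definable with parameters is a finite
union of intervals with bounds in `br(α) ∪ {-∞}`. -/
def BranchesOMinimal (L : Language) (T : Type*) [PartialOrder T] [L.Structure T] : Prop :=
  ∀ α : T, IsMax α → ∀ S ⊆ Set.Iic α, (Set.univ : Set T).Definable₁ L S →
    ∃ F : Set (Set T), F.Finite ∧ (∀ I ∈ F, IsBranchInterval α I) ∧ S = ⋃₀ F

/-- `br(α)` is the disjoint union of `{α}` and of the basic one-typed intervals
`I 0 < I 1 < ⋯ < I (n - 1)`. -/
structure IsDecomposition (L : Language) [L.Structure T] (α : T) {n : ℕ} (I : Fin n → Set T) :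
    Prop where
  oneTyped : ∀ j, IsBasicOneTyped L α (I j)
  lt : ∀ i j, i < j → ∀ x ∈ I i, ∀ y ∈ I j, x < y
  notMem : ∀ j, α ∉ I j
  union : (⋃ j, I j) ∪ {α} = Set.Iic α

/-- A decomposition of `br(α)` whose intervals are maximal one-typed: the union of two consecutive
intervals is not a basic one-typed interval. -/
structure IsMaximalDecomposition (L : Language) [L.Structure T] (α : T) {n : ℕ}
    (I : Fin n → Set T) : Prop extends IsDecomposition L α I where
  maximal : ∀ i j : Fin n, (i : ℕ) + 1 = j → ¬ IsBasicOneTyped L α (I i ∪ I j)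

/-- The possible forms of an interval: `{x}`, `]x, y[`, `]x, y]`. -/
inductive IntervalForm
  | singleton
  | openOpen
  | openClosed

/-- `I` is an interval of the branch of `α` of the given form, `x` being allowed to be `-∞`. The
intervals `]x, y[` are required to have no endpoint and the intervals `]x, y]` to have no least
element, so that the three forms exclude each other. -/
def HasForm (α : T) (I : Set T) : IntervalForm → Prop
  | .singleton => ∃ x ≤ α, I = {x}
  | .openOpen => I.Nonempty ∧ (∀ z ∈ I, ∃ w ∈ I, w < z) ∧ (∀ z ∈ I, ∃ w ∈ I, z < w) ∧
      ((∃ x ≤ α, ∃ y ≤ α, x < y ∧ I = Set.Ioo x y) ∨ ∃ y ≤ α, I = Set.Iio y)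
  | .openClosed => I.Nonempty ∧ (∀ z ∈ I, ∃ w ∈ I, w < z) ∧
      ((∃ x ≤ α, ∃ y ≤ α, x < y ∧ I = Set.Ioc x y) ∨ ∃ y ≤ α, I = Set.Iic y)

/-- The branches of the tree `T` have a uniform decomposition: for some `n ≥ 1` and each leaf `α`,
the branch of `α` has a maximal decomposition with `n` intervals; it is the only one (with any
number of intervals); its intervals are of the form `{x}`, `]x, y[` or `]x, y]`; the form of the
`j`-th interval and the type of its elements do not depend on `α`. -/
def HasUniformDecomposition (L : Language) (T : Type*) [PartialOrder T] [L.Structure T] : Prop :=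
  ∃ n : ℕ, 1 ≤ n ∧ ∃ I : {α : T // IsMax α} → Fin n → Set T,
    (∀ α, IsMaximalDecomposition L α.1 (I α)) ∧
    (∀ (α : {α : T // IsMax α}) (m : ℕ) (J : Fin m → Set T),
      IsMaximalDecomposition L α.1 J → ∃ e : m = n, ∀ j, J j = I α (Fin.cast e j)) ∧
    (∃ form : Fin n → IntervalForm, ∀ α j, HasForm α.1 (I α j) (form j)) ∧
    (∀ α β j, ∀ x ∈ I α j, ∀ y ∈ I β j, SameType L x y)

end Intervals

/-! ### Complete sets of tuples -/

/-! By the Ryll-Nardzewski theorem (`hasFinitelyManyTypes_of_categorical`), `M` has finitely many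
`∅`-definable sets in each arity. All types are then isolated and, `M` being countable,
back-and-forth makes tuples of the same type conjugate (`IsAtomicStructure.exists_equiv`).
Automorphisms of `M` act on `T` and preserve either structure on it, so `T` has the same two
properties. Indiscernibility makes all leaves conjugate, so it suffices to decompose one branch and
transport the result.

On a branch, call two elements linked when the closed interval between them is dense and one-typed.
This is an equivalence relation with convex classes, and the pieces of a maximal decomposition are
exactly the classes below the leaf; hence uniqueness (`IsMaximalDecomposition.unique`).

Existence means that there are finitely many classes and that each is an interval. The elements with
a successor in the branch form a definable set, hence a finite union of intervals. An infinite
interval of such elements would contain finite intervals of unboundedly many sizes, against the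
finiteness of the number of orbits on pairs; so this set is finite. Off it, each of the finitely
many types cuts the branch in a finite union of intervals, all dense and one-typed
(`exists_finite_cover_linked`). A class is a convex finite union of intervals, hence an interval.

Finally, a piece with a least element `x` and another element `y` is impossible: an automorphism
taking `y` to `x` would squeeze representatives of too many classes below `x`
(`IsMaximalDecomposition.exists_lt`). This leaves the three forms. -/

namespace FirstOrder.Language

open Set Structure

universe u v w w'

section Complete

variable (L : Language.{u, v}) {M : Type w} [L.Structure M]

/-- A set of tuples that is an atom of the Boolean algebra of `∅`-definable sets: the set of
realizations of an isolated complete type. -/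
structure IsCompleteSet {k : ℕ} (D : Set (Fin k → M)) : Prop where
  definable : (∅ : Set M).Definable L D
  nonempty : D.Nonempty
  subset_or_disjoint : ∀ E : Set (Fin k → M), (∅ : Set M).Definable L E → D ⊆ E ∨ Disjoint D E

/-- A tuple whose complete type is isolated. -/
def IsAtomicTuple {k : ℕ} (a : Fin k → M) : Prop :=
  ∃ D, IsCompleteSet L D ∧ a ∈ D

/-- A structure in which all complete types of finite tuples are isolated. -/
def IsAtomicStructure (M : Type w) [L.Structure M] : Prop :=
  ∀ (k : ℕ) (a : Fin k → M), IsAtomicTuple L a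

/-- A structure with finitely many `∅`-definable sets of `k`-tuples, for each `k`. -/
def HasFinitelyManyTypes (M : Type w) [L.Structure M] : Prop :=
  ∀ k : ℕ, {D : Set (Fin k → M) | (∅ : Set M).Definable L D}.Finite

variable {L}

theorem realize_iff_iff_mem_definable {k : ℕ} {a b : Fin k → M} :
    (∀ φ : L.Formula (Fin k), φ.Realize a ↔ φ.Realize b) ↔
      ∀ D, (∅ : Set M).Definable L D → (a ∈ D ↔ b ∈ D) := by
  constructor
  · intro h D hD
    obtain ⟨φ, rfl⟩ := Set.empty_definable_iff.1 hD
    exact h φ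
  · intro h φ
    exact h (Set.ofPred φ.Realize) (Set.empty_definable_iff.2 ⟨φ, rfl⟩)

theorem definable_relMap {n : ℕ} (R : L.Relations n) :
    (∅ : Set M).Definable L {v : Fin n → M | RelMap R v} :=
  Set.empty_definable_iff.2 ⟨R.formula Term.var, by ext; simp⟩

theorem Equiv.mem_iff_of_definable (g : M ≃[L] M) {α : Type*} {D : Set (α → M)}
    (hD : (∅ : Set M).Definable L D) (a : α → M) : g ∘ a ∈ D ↔ a ∈ D := by
  obtain ⟨φ, rfl⟩ := Set.empty_definable_iff.1 hD
  exact StrongHomClass.realize_formula g φ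

theorem IsCompleteSet.subset_of_mem {k : ℕ} {D E : Set (Fin k → M)} (hD : IsCompleteSet L D)
    (hE : (∅ : Set M).Definable L E) {a : Fin k → M} (haD : a ∈ D) (haE : a ∈ E) : D ⊆ E :=
  (hD.subset_or_disjoint E hE).resolve_right fun h => h.le_bot ⟨haD, haE⟩

/-- Reindexing coordinates pulls definable sets back to definable sets, so the image of an atom
cannot be split. -/
theorem IsAtomicTuple.comp {k m : ℕ} {a : Fin k → M} (ha : IsAtomicTuple L a)
    (r : Fin m → Fin k) : IsAtomicTuple L (a ∘ r) := by
  obtain ⟨D, hD, haD⟩ := ha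
  refine ⟨(fun g => g ∘ r) '' D, ⟨hD.definable.image_comp r, ⟨_, a, haD, rfl⟩, fun E hE => ?_⟩,
    a, haD, rfl⟩
  rcases hD.subset_or_disjoint _ (hE.preimage_comp r) with h | h
  · exact Or.inl (Set.image_subset_iff.2 h)
  · refine Or.inr (Set.disjoint_left.2 ?_)
    rintro _ ⟨x, hx, rfl⟩ hxE
    exact h.le_bot ⟨hx, hxE⟩

/-- The finitely many definable sets containing a tuple have a definable intersection, which
isolates its type. -/
theorem HasFinitelyManyTypes.isAtomicStructure (h : HasFinitelyManyTypes L M) :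
    IsAtomicStructure L M := by
  intro k a
  let 𝒟 : Set (Set (Fin k → M)) := {D | (∅ : Set M).Definable L D ∧ a ∈ D}
  have hfin : 𝒟.Finite := (h k).subset fun D hD => hD.1
  have : Finite 𝒟 := hfin
  have hdef : (∅ : Set M).Definable L (⋂ D : 𝒟, D.1) :=
    Set.definable_iInter_of_finite fun D => D.2.1
  have hmem : a ∈ ⋂ D : 𝒟, D.1 := Set.mem_iInter.2 fun D => D.2.2
  refine ⟨_, ⟨hdef, ⟨a, hmem⟩, fun E hE => ?_⟩, hmem⟩
  by_cases haE : a ∈ E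
  · exact Or.inl (Set.iInter_subset (fun D : 𝒟 => D.1) ⟨E, hE, haE⟩)
  · right
    have := Set.iInter_subset (fun D : 𝒟 => D.1) ⟨Eᶜ, hE.compl, haE⟩
    exact Set.disjoint_left.2 fun x hx => this hx

theorem hasFinitelyManyTypes_of_finite [Finite M] : HasFinitelyManyTypes L M :=
  fun _ => Set.toFinite _

/-- Every definable set is the union of the atoms of the cover that it contains. -/
theorem hasFinitelyManyTypes_of_cover
    (h : ∀ k, ∃ 𝒜 : Set (Set (Fin k → M)), 𝒜.Finite ∧ (∀ A ∈ 𝒜, IsCompleteSet L A) ∧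
      ⋃₀ 𝒜 = Set.univ) : HasFinitelyManyTypes L M := by
  intro k
  obtain ⟨𝒜, hfin, hat, hcov⟩ := h k
  refine (hfin.finite_subsets.image Set.sUnion).subset fun E hE => ?_
  refine ⟨{A ∈ 𝒜 | A ⊆ E}, fun A hA => hA.1, ?_⟩
  ext x
  constructor
  · rintro ⟨A, hA, hx⟩
    exact hA.2 hx
  · intro hx
    obtain ⟨A, hA, hxA⟩ : x ∈ ⋃₀ 𝒜 := hcov ▸ Set.mem_univ x
    exact ⟨A, ⟨hA, (hat A hA).subset_of_mem hE hxA hx⟩, hxA⟩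

/-- If automorphisms have finitely many orbits on `k`-tuples for all `k`, there are finitely many
`∅`-definable sets. -/
theorem hasFinitelyManyTypes_of_orbits
    (h : ∀ k, ∃ A : Set (Fin k → M), A.Finite ∧ ∀ a : Fin k → M, ∃ g : M ≃[L] M, g ∘ a ∈ A) :
    HasFinitelyManyTypes L M := by
  intro k
  obtain ⟨A, hA, hor⟩ := h k
  refine Set.Finite.of_finite_image (f := fun D => D ∩ A) ?_ ?_
  · refine hA.finite_subsets.subset ?_
    rintro _ ⟨D, -, rfl⟩
    exact Set.inter_subset_right
  · intro D hD E hE hDE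
    ext a
    obtain ⟨g, hg⟩ := hor a
    rw [← g.mem_iff_of_definable hD, ← g.mem_iff_of_definable hE]
    have := Set.ext_iff.1 hDE (g ∘ a)
    simpa [hg] using this

/-! ### Homogeneity of countable atomic structures -/

/-- A set of pairs is elementary if the first and the second coordinates of tuples from it have the
same type. -/
def IsElementaryRel (L : Language.{u, v}) {M : Type w} [L.Structure M] (s : Set (M × M)) : Prop :=
  ∀ (k : ℕ) (p : Fin k → M × M), (∀ i, p i ∈ s) → ∀ D, (∅ : Set M).Definable L D →
    ((fun i => (p i).1) ∈ D ↔ (fun i => (p i).2) ∈ D)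

theorem isElementaryRel_range {k : ℕ} (p : Fin k → M × M)
    (h : ∀ D, (∅ : Set M).Definable L D →
      ((fun i => (p i).1) ∈ D ↔ (fun i => (p i).2) ∈ D)) : IsElementaryRel L (Set.range p) := by
  intro m q hq D hD
  choose r hr using hq
  obtain rfl : p ∘ r = q := funext hr
  exact h _ (hD.preimage_comp r)

theorem IsElementaryRel.swap {s : Set (M × M)} (h : IsElementaryRel L s) :
    IsElementaryRel L (Prod.swap '' s) := by
  intro k p hp D hD
  choose q hq hqp using hp
  have := h k q hq D hD
  simp only [← hqp, Prod.fst_swap, Prod.snd_swap]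
  exact this.symm

/-- The extension step of the back-and-forth. The projection of an atom containing the first
coordinates followed by `c` is definable and contains the first coordinates, hence also the second
ones; a lift of the latter to the atom supplies `d`. -/
theorem IsElementaryRel.exists_insert (hM : IsAtomicStructure L M) {s : Set (M × M)}
    (hs : s.Finite) (h : IsElementaryRel L s) (c : M) :
    ∃ d, IsElementaryRel L (insert (c, d) s) := by
  obtain ⟨k, p, -, rfl⟩ := hs.fin_param
  obtain ⟨D, hD, haD⟩ := hM (k + 1) (Fin.snoc (fun i => (p i).1) c)
  have himg := (h k p (fun i => ⟨i, rfl⟩) _ (hD.definable.image_comp Fin.castSucc)).1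
    ⟨_, haD, by ext i; simp⟩
  obtain ⟨w, hwD, hw⟩ := himg
  refine ⟨w (Fin.last k), ?_⟩
  have hrange : insert (c, w (Fin.last k)) (Set.range p) =
      Set.range (Fin.snoc p (c, w (Fin.last k)) : Fin (k + 1) → M × M) := by
    ext x
    constructor
    · rintro (rfl | ⟨i, rfl⟩)
      · exact ⟨Fin.last k, by simp⟩
      · exact ⟨i.castSucc, by simp⟩
    · rintro ⟨i, rfl⟩
      induction i using Fin.lastCases with
      | last => simp
      | cast i => simp
  rw [hrange]
  refine isElementaryRel_range _ fun E hE => ?_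
  have h1 : (fun i => ((Fin.snoc p (c, w (Fin.last k)) : Fin (k + 1) → M × M) i).1) =
      Fin.snoc (fun i => (p i).1) c := by
    ext i
    induction i using Fin.lastCases with
    | last => simp
    | cast i => simp
  have h2 : (fun i => ((Fin.snoc p (c, w (Fin.last k)) : Fin (k + 1) → M × M) i).2) = w := by
    ext i
    induction i using Fin.lastCases with
    | last => simp
    | cast i => simpa using (congrFun hw i).symm
  rw [h1, h2]
  exact ⟨fun hE1 => hD.subset_of_mem hE haD hE1 hwD, fun hE2 => hD.subset_of_mem hE hwD hE2 haD⟩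

/-- Countably many density requirements are met along one increasing sequence. This drives both the
back-and-forth and the construction of an atomic submodel. -/
theorem exists_monotone_seq {P ι : Type*} [Preorder P] [Countable ι] (p : P)
    (𝒟 : ι → Order.Cofinal P) : ∃ f : ℕ → P, Monotone f ∧ f 0 = p ∧ ∀ i, ∃ n, f n ∈ 𝒟 i := by
  have := Encodable.ofCountable ι
  exact ⟨_, Order.sequenceOfCofinals.monotone p 𝒟, rfl,
    fun i => ⟨_, Order.sequenceOfCofinals.encode_mem p 𝒟 i⟩⟩

theorem exists_mem_of_monotone {α : Type*} {f : ℕ → Set α} (hf : Monotone f) {k : ℕ}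
    {p : Fin k → α} (hp : ∀ i, p i ∈ ⋃ n, f n) : ∃ n, ∀ i, p i ∈ f n := by
  choose m hm using fun i => Set.mem_iUnion.1 (hp i)
  exact ⟨Finset.univ.sup m, fun i => hf (Finset.le_sup (Finset.mem_univ i)) (hm i)⟩

theorem IsElementaryRel.iUnion {f : ℕ → Set (M × M)} (hf : Monotone f)
    (h : ∀ n, IsElementaryRel L (f n)) : IsElementaryRel L (⋃ n, f n) := by
  intro k p hp D hD
  obtain ⟨n, hn⟩ := exists_mem_of_monotone hf hp
  exact h n k p hn D hD

/-- An elementary relation that is total in both directions is the graph of an automorphism. -/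
theorem IsElementaryRel.exists_equiv {G : Set (M × M)} (h : IsElementaryRel L G)
    (hl : ∀ x, ∃ y, (x, y) ∈ G) (hr : ∀ y, ∃ x, (x, y) ∈ G) :
    ∃ g : M ≃[L] M, ∀ x y, (x, y) ∈ G → g x = y := by
  have heq : ∀ p ∈ G, ∀ q ∈ G, p.1 = q.1 ↔ p.2 = q.2 := by
    intro p hp q hq
    have hdef : (∅ : Set M).Definable L {v : Fin 2 → M | v 0 = v 1} :=
      Set.empty_definable_iff.2 ⟨(Term.var 0).equal (Term.var 1), by ext; simp⟩
    simpa using h 2 ![p, q] (by simp [Fin.forall_fin_two, hp, hq]) _ hdef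
  choose f hf using hl
  choose e he using hr
  have hfG : ∀ x y, (x, y) ∈ G → f x = y := fun x y hxy => (heq _ (hf x) _ hxy).1 rfl
  refine ⟨⟨⟨f, e, fun x => (heq _ (he (f x)) _ (hf x)).2 rfl, fun y => hfG _ _ (he y)⟩, ?_, ?_⟩,
    hfG⟩
  · intro n φ x
    have hdef : (∅ : Set M).Definable L
        {v : Fin (n + 1) → M | funMap φ (fun i => v (Fin.castSucc i)) = v (Fin.last n)} :=
      Set.empty_definable_iff.2
        ⟨(Term.func φ fun i => Term.var (Fin.castSucc i)).equal (Term.var (Fin.last n)), by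
          ext; simp⟩
    have := h (n + 1) (Fin.snoc (fun i => (x i, f (x i))) (funMap φ x, f (funMap φ x)))
      (fun i => by
        induction i using Fin.lastCases with
        | last => simpa using hf _
        | cast i => simpa using hf _) _ hdef
    simpa [Function.comp_def, eq_comm] using this
  · intro n R x
    exact (h n (fun i => (x i, f (x i))) (fun i => hf _) _ (definable_relMap R)).symm

/-- In a countable atomic structure, tuples of the same type are conjugate. -/
theorem IsAtomicStructure.exists_equiv [Countable M] (hM : IsAtomicStructure L M) {k : ℕ}
    {a b : Fin k → M} (hab : ∀ φ : L.Formula (Fin k), φ.Realize a ↔ φ.Realize b) :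
    ∃ g : M ≃[L] M, g ∘ a = b := by
  classical
  let P := {s : Finset (M × M) // IsElementaryRel L (s : Set (M × M))}
  have h0 : IsElementaryRel L (Set.range fun i => (a i, b i)) :=
    isElementaryRel_range _ (realize_iff_iff_mem_definable.1 hab)
  let p0 : P := ⟨Finset.univ.image fun i => (a i, b i), by simpa using h0⟩
  -- Left indices put an element in the domain, right indices in the range.
  let 𝒟 : M ⊕ M → Order.Cofinal P := Sum.elim
    (fun c => ⟨{s | ∃ d, (c, d) ∈ s.1}, fun s => by
      obtain ⟨d, hd⟩ := s.2.exists_insert hM s.1.finite_toSet c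
      exact ⟨⟨insert (c, d) s.1, by simpa using hd⟩, ⟨d, by simp⟩,
        Subtype.mk_le_mk.2 (Finset.subset_insert _ _)⟩⟩)
    (fun c => ⟨{s | ∃ d, (d, c) ∈ s.1}, fun s => by
      obtain ⟨d, hd⟩ := s.2.swap.exists_insert hM (s.1.finite_toSet.image _) c
      refine ⟨⟨insert (d, c) s.1, ?_⟩, ⟨d, by simp⟩,
        Subtype.mk_le_mk.2 (Finset.subset_insert _ _)⟩
      have := hd.swap
      rw [Set.image_insert_eq, Set.image_image] at this
      simpa using this⟩)
  obtain ⟨f, hf, hf0, hfD⟩ := exists_monotone_seq p0 𝒟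
  have hmono : Monotone fun n => ((f n).1 : Set (M × M)) := fun m n hmn =>
    Finset.coe_subset.2 (hf hmn)
  obtain ⟨g, hg⟩ := (IsElementaryRel.iUnion hmono fun n => (f n).2).exists_equiv
    (fun x => by
      obtain ⟨n, d, hd⟩ := hfD (Sum.inl x)
      exact ⟨d, Set.mem_iUnion.2 ⟨n, hd⟩⟩)
    (fun x => by
      obtain ⟨n, d, hd⟩ := hfD (Sum.inr x)
      exact ⟨d, Set.mem_iUnion.2 ⟨n, hd⟩⟩)
  refine ⟨g, funext fun i => hg _ _ (Set.mem_iUnion.2 ⟨0, ?_⟩)⟩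
  rw [hf0]
  simpa [p0] using ⟨i, rfl, rfl⟩

theorem HasFinitelyManyTypes.exists_orbits [Countable M] (h : HasFinitelyManyTypes L M) (k : ℕ) :
    ∃ A : Set (Fin k → M), A.Finite ∧ ∀ a : Fin k → M, ∃ g : M ≃[L] M, g ∘ a ∈ A := by
  let t : (Fin k → M) → Set (Set (Fin k → M)) := fun a => {D | (∅ : Set M).Definable L D ∧ a ∈ D}
  have hfin : (Set.range t).Finite := by
    refine (h k).finite_subsets.subset ?_
    rintro _ ⟨a, rfl⟩ D hD
    exact hD.1
  have : Finite (Set.range t) := hfin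
  refine ⟨Set.range (Set.rangeSplitting t), Set.finite_range _, fun a => ?_⟩
  have hb := Set.apply_rangeSplitting t ⟨t a, a, rfl⟩
  obtain ⟨g, hg⟩ := h.isAtomicStructure.exists_equiv (a := a)
    (b := Set.rangeSplitting t ⟨t a, a, rfl⟩)
    (realize_iff_iff_mem_definable.2 fun D hD => by
      have := Set.ext_iff.1 hb D
      simpa [t, hD] using this.symm)
  exact ⟨g, hg ▸ ⟨_, rfl⟩⟩

end Complete

end FirstOrder.Language

/-! ### The Ryll-Nardzewski theorem -/

namespace FirstOrder.Language

open Set Structure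

universe u v w w' a b

section RyllNardzewski

variable {L : Language.{u, v}}

/-- Categoricity quantifies over models in one fixed universe; copying onto `ULift ℕ` brings
countable models from any universe into it. -/
theorem exists_modelType_equiv {T : L.Theory} (N : Type a) [L.Structure N] [N ⊨ T] [Countable N]
    [Infinite N] : ∃ N' : T.ModelType, Cardinal.mk N' = Cardinal.aleph0.{w'} ∧
      Nonempty (N ≃[L] N') := by
  obtain ⟨e⟩ : Nonempty (N ≃ ULift.{w'} ℕ) := by
    obtain ⟨e⟩ := nonempty_equiv_of_countable (α := N) (β := ℕ)
    exact ⟨e.trans _root_.Equiv.ulift.symm⟩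
  let : L.Structure (ULift.{w'} ℕ) := e.inducedStructure
  have : ULift.{w'} ℕ ⊨ T := StrongHomClass.theory_model (e.inducedStructureEquiv (L := L))
  exact ⟨Theory.ModelType.of T (ULift.{w'} ℕ), by simp, ⟨e.inducedStructureEquiv⟩⟩

theorem nonempty_equiv_of_categorical {T : L.Theory} (h : Cardinal.aleph0.{w'}.Categorical T)
    (N₁ : Type a) [L.Structure N₁] [N₁ ⊨ T] [Countable N₁] [Infinite N₁]
    (N₂ : Type b) [L.Structure N₂] [N₂ ⊨ T] [Countable N₂] [Infinite N₂] :
    Nonempty (N₁ ≃[L] N₂) := by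
  obtain ⟨N₁', h₁, ⟨e₁⟩⟩ := exists_modelType_equiv.{u, v, w', a} (T := T) N₁
  obtain ⟨N₂', h₂, ⟨e₂⟩⟩ := exists_modelType_equiv.{u, v, w', b} (T := T) N₂
  obtain ⟨e⟩ := h N₁' N₂' h₁ h₂
  exact ⟨e₂.symm.comp (e.comp e₁)⟩

variable [Countable L.Symbols] {M : Type w} [L.Structure M] [Countable M] [Infinite M]

/-- The countable model of an `ℵ₀`-categorical theory realizes all types over `∅`. -/
theorem exists_realize_of_categorical
    (hcat : Cardinal.aleph0.{w'}.Categorical (L.completeTheory M)) {k : ℕ}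
    (Γ : Set (L.Formula (Fin k)))
    (hΓ : ∀ Γ₀ : Finset (L.Formula (Fin k)), (Γ₀ : Set _) ⊆ Γ →
      ∃ v : Fin k → M, ∀ φ ∈ Γ₀, φ.Realize v) :
    ∃ v : Fin k → M, ∀ φ ∈ Γ, φ.Realize v := by
  classical
  -- New constants name a realization of `Γ`. Finite parts are satisfied in `M` itself, and the
  -- reduct to `L` of a countable model is isomorphic to `M`.
  let T : L[[Fin k]].Theory :=
    (L.lhomWithConstants (Fin k)).onTheory (L.completeTheory M) ∪ Formula.equivSentence '' Γ
  have hT : T.IsSatisfiable := by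
    rw [Theory.isSatisfiable_iff_isFinitelySatisfiable]
    intro T₀ hT₀
    have : (T₀ : Set _) ∩ Formula.equivSentence '' Γ ⊆ Formula.equivSentence '' Γ :=
      Set.inter_subset_right
    obtain ⟨Γ₀, hΓ₀, hΓT⟩ := Set.subset_image_iff.1 this
    have hfin : Γ₀.Finite := by
      refine Set.Finite.of_finite_image (f := Formula.equivSentence) ?_
        (Formula.equivSentence.injective.injOn)
      rw [hΓT]
      exact T₀.finite_toSet.subset Set.inter_subset_left
    obtain ⟨x, hx⟩ := hΓ hfin.toFinset (by simpa using hΓ₀)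
    let : (constantsOn (Fin k)).Structure M := constantsOn.structure x
    have hM : M ⊨ (T₀ : L[[Fin k]].Theory) := by
      refine ⟨fun φ hφ => ?_⟩
      rcases hT₀ hφ with h | h
      · have : M ⊨ (L.lhomWithConstants (Fin k)).onTheory (L.completeTheory M) :=
          (LHom.onTheory_model _ _).2 inferInstance
        exact this.realize_of_mem φ h
      · have : φ ∈ Formula.equivSentence '' Γ₀ := hΓT ▸ ⟨hφ, h⟩
        obtain ⟨ψ, hψ, rfl⟩ := this
        rw [Formula.realize_equivSentence]
        exact hx ψ (by simpa using hψ)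
    exact Theory.Model.isSatisfiable M
  obtain ⟨N⟩ := hT
  let : L.Structure N := (L.lhomWithConstants (Fin k)).reduct N
  have hNM : N ⊨ L.completeTheory M :=
    (LHom.onTheory_model (L.lhomWithConstants (Fin k)) _).1
      (Theory.Model.mono N.is_model Set.subset_union_left)
  have hNinf : Infinite N := by
    have : M ≅[L] N := by
      rw [elementarilyEquivalent_iff]
      intro φ
      exact (realize_iff_of_model_completeTheory M N φ).symm
    exact this.infinite_iff.1 inferInstance
  obtain ⟨N', hN', hcard⟩ := exists_elementarilyEquivalent_card_eq L[[Fin k]] N Cardinal.aleph0.{w'}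
    le_rfl (by
      simp only [Cardinal.lift_aleph0, Cardinal.lift_le_aleph0]
      exact Cardinal.mk_le_aleph0)
  have hN'T : N' ⊨ T := hN'.theory_model
  let : L.Structure N' := (L.lhomWithConstants (Fin k)).reduct N'
  have : N' ⊨ L.completeTheory M :=
    (LHom.onTheory_model (L.lhomWithConstants (Fin k)) _).1
      (Theory.Model.mono hN'T Set.subset_union_left)
  have : Infinite N' := Cardinal.infinite_iff.2 hcard.ge
  have : Countable N' := Cardinal.mk_le_aleph0_iff.1 hcard.le
  obtain ⟨e⟩ := nonempty_equiv_of_categorical hcat N' M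
  refine ⟨e ∘ fun i => (L.con i : N'), fun φ hφ => ?_⟩
  rw [StrongHomClass.realize_formula e]
  rw [← Formula.realize_equivSentence]
  exact hN'T.realize_of_mem _ (Or.inr ⟨φ, hφ, rfl⟩)

theorem exists_mem_sInter_of_categorical
    (hcat : Cardinal.aleph0.{w'}.Categorical (L.completeTheory M)) {k : ℕ}
    (𝒟 : Set (Set (Fin k → M))) (hdef : ∀ D ∈ 𝒟, (∅ : Set M).Definable L D)
    (h𝒟 : ∀ 𝒟₀ ⊆ 𝒟, 𝒟₀.Finite → (⋂₀ 𝒟₀).Nonempty) : (⋂₀ 𝒟).Nonempty := by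
  obtain ⟨x, hx⟩ := exists_realize_of_categorical hcat
    {φ : L.Formula (Fin k) | Set.ofPred φ.Realize ∈ 𝒟} (fun Γ₀ hΓ₀ => by
      let r : L.Formula (Fin k) → Set (Fin k → M) := fun φ => Set.ofPred φ.Realize
      obtain ⟨x, hx⟩ := h𝒟 (r '' Γ₀) (Set.image_subset_iff.2 fun φ hφ => hΓ₀ hφ)
        (Γ₀.finite_toSet.image _)
      exact ⟨x, fun φ hφ => hx _ ⟨φ, hφ, rfl⟩⟩)
  refine ⟨x, fun D hD => ?_⟩
  obtain ⟨φ, rfl⟩ := Set.empty_definable_iff.1 (hdef D hD)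
  exact hx φ hD

end RyllNardzewski

end FirstOrder.Language

/-! ### Isolated types and atomic submodels of the countable model -/

namespace FirstOrder.Language

open Set Structure

universe u v w w'

section RyllNardzewski

variable {L : Language.{u, v}} [Countable L.Symbols] {M : Type w} [L.Structure M] [Countable M]
  [Infinite M]

/-- In the countable model of an `ℵ₀`-categorical theory, isolated types are dense. -/
theorem exists_isCompleteSet_subset (hcat : Cardinal.aleph0.{w'}.Categorical (L.completeTheory M))
    {k : ℕ} {D : Set (Fin k → M)} (hD : (∅ : Set M).Definable L D) (hne : D.Nonempty) :
    ∃ A ⊆ D, IsCompleteSet L A := by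
  by_contra! hno
  -- A definable subset of `D` that is not an atom splits into two nonempty definable parts, and one
  -- of them avoids `a`.
  have hsplit : ∀ E : Set (Fin k → M), (∅ : Set M).Definable L E → E.Nonempty → E ⊆ D →
      ∀ a, ∃ E' ⊆ E, (∅ : Set M).Definable L E' ∧ E'.Nonempty ∧ a ∉ E' := by
    intro E hE hEne hED a
    by_contra! h
    refine hno E hED ⟨hE, hEne, fun F hF => ?_⟩
    by_contra! hF'
    obtain ⟨x, hxE, hxF⟩ := Set.not_subset.1 hF'.1
    obtain ⟨y, hyE, hyF⟩ := Set.not_disjoint_iff.1 hF'.2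
    exact (h (E \ F) Set.sdiff_subset (hE.sdiff hF) ⟨x, hxE, hxF⟩).2
      (h (E ∩ F) Set.inter_subset_left (hE.inter hF) ⟨y, hyE, hyF⟩).2
  obtain ⟨e, he⟩ := exists_surjective_nat (Fin k → M)
  let Q := {E : Set (Fin k → M) // (∅ : Set M).Definable L E ∧ E.Nonempty ∧ E ⊆ D}
  have hstep : ∀ (n : ℕ) (E : Q), ∃ E' : Q, E'.1 ⊆ E.1 ∧ e n ∉ E'.1 := by
    intro n E
    obtain ⟨E', hE', h1, h2, h3⟩ := hsplit E.1 E.2.1 E.2.2.1 E.2.2.2 (e n)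
    exact ⟨⟨E', h1, h2, hE'.trans E.2.2.2⟩, hE', h3⟩
  choose s hs hsn using hstep
  -- Stage `n + 1` avoids the `n`-th tuple of an enumeration of all `k`-tuples, so the intersection
  -- is empty, although the realization of types makes it nonempty.
  let f : ℕ → Q := fun n => Nat.rec ⟨D, hD, hne, subset_rfl⟩ (fun n E => s n E) n
  have hanti : Antitone fun n => (f n).1 := antitone_nat_of_succ_le fun n => hs n (f n)
  obtain ⟨x, hx⟩ := exists_mem_sInter_of_categorical hcat (Set.range fun n => (f n).1)
    (by rintro _ ⟨n, rfl⟩; exact (f n).2.1) (fun 𝒟₀ h𝒟₀ hfin => by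
      obtain ⟨t, rfl⟩ := Set.subset_range_iff_exists_image_eq.1 h𝒟₀
      obtain ⟨t', ht', ht'fin, hteq⟩ : ∃ t' ⊆ t, t'.Finite ∧
          (fun n => (f n).1) '' t = (fun n => (f n).1) '' t' := by
        exact Set.exists_subset_image_finite_and.1
          ⟨(fun n => (f n).1) '' t, subset_rfl, hfin, rfl⟩
      rw [hteq]
      obtain ⟨N, hN⟩ := ht'fin.bddAbove
      obtain ⟨x, hx⟩ := (f N).2.2.1
      refine ⟨x, ?_⟩
      rintro _ ⟨n, hn, rfl⟩
      exact hanti (hN hn) hx)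
  obtain ⟨n, rfl⟩ := he x
  exact hsn n (f n) (hx _ ⟨n + 1, rfl⟩)

/-- Density of isolated types over the atomic parameter `x`: an atom inside `E` and above the atom
`D` of `x` projects onto a definable set meeting `D`, hence containing `x`. -/
theorem IsAtomicTuple.exists_snoc (hcat : Cardinal.aleph0.{w'}.Categorical (L.completeTheory M))
    {k : ℕ} {x : Fin k → M} (hx : IsAtomicTuple L x) {E : Set (Fin (k + 1) → M)}
    (hE : (∅ : Set M).Definable L E) {c : M} (hc : (Fin.snoc x c : Fin (k + 1) → M) ∈ E) :
    ∃ d : M, (Fin.snoc x d : Fin (k + 1) → M) ∈ E ∧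
      IsAtomicTuple L (Fin.snoc x d : Fin (k + 1) → M) := by
  obtain ⟨D, hD, hxD⟩ := hx
  have hx' : ∀ d, (Fin.snoc x d : Fin (k + 1) → M) ∘ Fin.castSucc = x := fun d => by ext; simp
  obtain ⟨A, hAE, hA⟩ := exists_isCompleteSet_subset hcat
    (hE.inter (hD.definable.preimage_comp Fin.castSucc)) ⟨_, hc, by simpa [hx'] using hxD⟩
  obtain ⟨w, hw⟩ := hA.nonempty
  obtain ⟨y, hyA, hy⟩ := hD.subset_of_mem (hA.definable.image_comp Fin.castSucc) (hAE hw).2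
    ⟨w, hw, rfl⟩ hxD
  have hyx : (Fin.snoc x (y (Fin.last k)) : Fin (k + 1) → M) = y := by
    ext i
    induction i using Fin.lastCases with
    | last => simp
    | cast i => simpa using (congrFun hy i).symm
  exact ⟨y (Fin.last k), by rw [hyx]; exact (hAE hyA).1, A, hA, by rw [hyx]; exact hyA⟩

/-- The countable model of an `ℵ₀`-categorical theory has an atomic elementary substructure. -/
theorem exists_atomic_elementarySubstructure
    (hcat : Cardinal.aleph0.{w'}.Categorical (L.completeTheory M)) :
    ∃ S : L.ElementarySubstructure M, ∀ (k : ℕ) (x : Fin k → S),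
      IsAtomicTuple L fun i => (x i : M) := by
  classical
  let P := {s : Finset M // ∀ (k : ℕ) (x : Fin k → M), (∀ i, x i ∈ s) → IsAtomicTuple L x}
  have hPof : ∀ (k : ℕ) (x : Fin k → M), IsAtomicTuple L x → ∀ (m : ℕ) (y : Fin m → M),
      (∀ i, y i ∈ Finset.univ.image x) → IsAtomicTuple L y := by
    intro k x hx m y hy
    have : ∀ i, ∃ j, x j = y i := fun i => by simpa using hy i
    choose r hr using this
    obtain rfl : x ∘ r = y := funext hr
    exact hx.comp r
  -- The sequence starts at the empty set, which is admissible because the empty tuple is atomic.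
  obtain ⟨A₀, -, hA₀⟩ := exists_isCompleteSet_subset hcat (k := 0) (D := Set.univ)
    Set.definable_univ ⟨Fin.elim0, trivial⟩
  obtain ⟨x₀, hx₀⟩ := hA₀.nonempty
  let p0 : P := ⟨Finset.univ.image x₀, hPof 0 x₀ ⟨A₀, hA₀, hx₀⟩⟩
  -- Tarski-Vaught requirements. The last alternative makes the requirement cofinal even when no
  -- extension ever contains the parameters; it fails for parameters from the union, which all
  -- belong to some stage beyond `s`.
  let 𝒟 : (Σ n, L.Formula (Fin (n + 1)) × (Fin n → M)) → Order.Cofinal P := fun i =>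
    ⟨{s | (∃ b ∈ s.1, i.2.1.Realize (Fin.snoc i.2.2 b : Fin (i.1 + 1) → M)) ∨
      (∀ a, ¬ i.2.1.Realize (Fin.snoc i.2.2 a : Fin (i.1 + 1) → M)) ∨
        ∀ t ≥ s, ¬ ∀ j, i.2.2 j ∈ t.1}, fun s => by
      obtain ⟨n, φ, x⟩ := i
      by_cases hs : ∀ t ≥ s, ¬ ∀ j, x j ∈ t.1
      · exact ⟨s, Or.inr (Or.inr hs), le_rfl⟩
      by_cases hφ : ∀ a, ¬ φ.Realize (Fin.snoc x a : Fin (n + 1) → M)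
      · exact ⟨s, Or.inr (Or.inl hφ), le_rfl⟩
      push Not at hs hφ
      obtain ⟨t, hst, hxt⟩ := hs
      obtain ⟨a, ha⟩ := hφ
      obtain ⟨k, u, -, hu⟩ := t.1.finite_toSet.fin_param
      have hut : ∀ i, u i ∈ t.1 := fun i => by
        rw [← Finset.mem_coe, ← hu]
        exact ⟨i, rfl⟩
      have : ∀ j, ∃ i, u i = x j := fun j => by
        have := hxt j
        rwa [← Finset.mem_coe, ← hu] at this
      choose r hr using this
      have hsnoc : ∀ c, (Fin.snoc u c : Fin (k + 1) → M) ∘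
          (Fin.snoc (fun i => (r i).castSucc) (Fin.last k) : Fin (n + 1) → Fin (k + 1)) =
            Fin.snoc x c := by
        intro c
        ext i
        induction i using Fin.lastCases with
        | last => simp
        | cast i => simp [hr]
      have hdef := (Set.empty_definable_iff.2 ⟨φ, rfl⟩ :
        (∅ : Set M).Definable L (Set.ofPred φ.Realize)).preimage_comp
          (Fin.snoc (fun i => (r i).castSucc) (Fin.last k) : Fin (n + 1) → Fin (k + 1))
      obtain ⟨d, hd, hatom⟩ := (t.2 k u hut).exists_snoc hcat hdef (c := a) (by
        rw [Set.mem_preimage, hsnoc]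
        exact ha)
      rw [Set.mem_preimage, hsnoc] at hd
      refine ⟨⟨Finset.univ.image (Fin.snoc u d : Fin (k + 1) → M), hPof _ _ hatom⟩,
        Or.inl ⟨d, ?_, hd⟩, hst.trans ?_⟩
      · simp only [Finset.mem_image, Finset.mem_univ, true_and]
        exact ⟨Fin.last k, by simp⟩
      · intro y hy
        rw [← Finset.mem_coe, ← hu] at hy
        obtain ⟨i, rfl⟩ := hy
        simp only [Finset.mem_image, Finset.mem_univ, true_and]
        exact ⟨i.castSucc, by simp⟩⟩
  obtain ⟨f, hf, -, hfD⟩ := exists_monotone_seq p0 𝒟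
  have hmono : Monotone fun n => ((f n).1 : Set M) := fun m n hmn => Finset.coe_subset.2 (hf hmn)
  let U : Set M := ⋃ n, ((f n).1 : Set M)
  have hU : ∀ (n : ℕ) (φ : L.Formula (Fin (n + 1))) (x : Fin n → M), (∀ i, x i ∈ U) → ∀ a,
      φ.Realize (Fin.snoc x a : Fin (n + 1) → M) →
        ∃ b ∈ U, φ.Realize (Fin.snoc x b : Fin (n + 1) → M) := by
    intro n φ x hx a ha
    obtain ⟨m, hm⟩ := hfD ⟨n, φ, x⟩
    obtain ⟨l, hl⟩ := exists_mem_of_monotone hmono hx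
    rcases hm with ⟨b, hb, hφ⟩ | h | h
    · exact ⟨b, Set.mem_iUnion.2 ⟨m, hb⟩, hφ⟩
    · exact absurd ha (h a)
    · exact absurd (fun j => hmono (le_max_right m l) (hl j)) (h (f (max m l)) (hf (le_max_left m l)))
  let S : L.Substructure M := ⟨U, fun {n} F x hx => by
    obtain ⟨b, hb, hφ⟩ := hU n
      ((Term.func F fun i => Term.var (Fin.castSucc i)).equal (Term.var (Fin.last n))) x hx
      (funMap F x) (by simp)
    have : funMap F x = b := by simpa using hφ
    exact this ▸ hb⟩
  refine ⟨S.toElementarySubstructure fun n φ x a ha => ?_, fun k x => ?_⟩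
  · have key : ∀ v : Fin (n + 1) → M,
        (φ.toFormula.relabel (Sum.elim Empty.elim id) : L.Formula (Fin (n + 1))).Realize v ↔
          φ.Realize default v := by
      intro v
      rw [Formula.realize_relabel, BoundedFormula.realize_toFormula]
      exact iff_of_eq (congrArg₂ _ (Subsingleton.elim _ _) rfl)
    obtain ⟨b, hb, hφ⟩ := hU n (φ.toFormula.relabel (Sum.elim Empty.elim id)) (fun i => x i)
      (fun i => (x i).2) a ((key _).2 ha)
    exact ⟨⟨b, hb⟩, (key _).1 hφ⟩
  · obtain ⟨l, hl⟩ := exists_mem_of_monotone hmono fun i => (x i).2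
    exact (f l).2 k _ hl

/-- **Ryll-Nardzewski theorem**, for the countable model of an `ℵ₀`-categorical theory. -/
theorem hasFinitelyManyTypes_of_categorical_of_infinite
    (hcat : Cardinal.aleph0.{w'}.Categorical (L.completeTheory M)) :
    HasFinitelyManyTypes L M := by
  obtain ⟨S, hS⟩ := exists_atomic_elementarySubstructure hcat
  have : S ⊨ L.completeTheory M := inferInstance
  have : Infinite S := S.elementarilyEquivalent.infinite_iff.2 inferInstance
  obtain ⟨e⟩ := nonempty_equiv_of_categorical hcat S M
  refine hasFinitelyManyTypes_of_cover fun k => ?_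
  by_contra! hno
  -- If no finite family of atoms covered, the complements of atoms would have the finite
  -- intersection property. The resulting `x` lies in no atom, yet its copy in the atomic submodel
  -- `S` does.
  obtain ⟨x, hx⟩ := exists_mem_sInter_of_categorical hcat
    {D : Set (Fin k → M) | IsCompleteSet L Dᶜ} (fun D hD => by simpa using hD.definable.compl)
    (fun 𝒟₀ h𝒟₀ hfin => by
      by_contra! hempty
      refine hno (compl '' 𝒟₀) (hfin.image _) ?_ ?_
      · rintro _ ⟨D, hD, rfl⟩
        exact h𝒟₀ hD
      · rw [← Set.compl_sInter, hempty, Set.compl_empty])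
  obtain ⟨D, hD, hxD⟩ := hS k (e.symm ∘ x)
  refine hx Dᶜ (by simpa using hD) ?_
  obtain ⟨φ, rfl⟩ := Set.empty_definable_iff.1 hD.definable
  have h1 : φ.Realize (S.subtype ∘ (e.symm ∘ x)) := hxD
  rw [ElementaryEmbedding.map_formula, StrongHomClass.realize_formula e.symm] at h1
  exact h1

end RyllNardzewski

theorem hasFinitelyManyTypes_of_categorical {L : Language.{u, v}} [Countable L.Symbols]
    {M : Type w} [L.Structure M] [Countable M]
    (hcat : Cardinal.aleph0.{w'}.Categorical (L.completeTheory M)) :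
    HasFinitelyManyTypes L M := by
  rcases finite_or_infinite M with _ | _
  · exact hasFinitelyManyTypes_of_finite
  · exact hasFinitelyManyTypes_of_categorical_of_infinite hcat

end FirstOrder.Language

/-! ### Dense one-typed intervals of branches -/

theorem SameType.refl {L : Language} {N : Type*} [L.Structure N] (a : N) : SameType L a a :=
  fun _ => Iff.rfl

theorem SameType.symm {L : Language} {N : Type*} [L.Structure N] {a b : N} (h : SameType L a b) :
    SameType L b a :=
  fun φ => (h φ).symm

theorem SameType.trans {L : Language} {N : Type*} [L.Structure N] {a b c : N}
    (h : SameType L a b) (h' : SameType L b c) : SameType L a c :=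
  fun φ => (h φ).trans (h' φ)

/-- Elements with a common upper bound are comparable. -/
def BranchesAreChains (T : Type*) [PartialOrder T] : Prop :=
  ∀ z x y : T, x ≤ z → y ≤ z → x ≤ y ∨ y ≤ x

section Branches

variable {T : Type*} [PartialOrder T]

theorem IsBranchInterval.subset_Iic {α : T} {I : Set T} (hI : IsBranchInterval α I) :
    I ⊆ Set.Iic α := by
  intro x hx
  rcases hI with ⟨a, ha, b, hb, rfl | rfl | rfl | rfl⟩ | ⟨b, hb, rfl | rfl⟩
  · exact hx.2.trans hb
  · exact hx.2.le.trans hb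
  · exact hx.2.trans hb
  · exact hx.2.le.trans hb
  · exact le_trans hx hb
  · exact (le_of_lt hx).trans hb

theorem IsBranchInterval.ordConnected {α : T} {I : Set T} (hI : IsBranchInterval α I) :
    I.OrdConnected := by
  rcases hI with ⟨a, ha, b, hb, rfl | rfl | rfl | rfl⟩ | ⟨b, hb, rfl | rfl⟩ <;> infer_instance

theorem isBranchInterval_singleton {α x : T} (hx : x ≤ α) : IsBranchInterval α {x} :=
  Or.inl ⟨x, hx, x, hx, Or.inl (Set.Icc_self x).symm⟩

theorem IsBasicInterval.isBranchInterval {α : T} {I : Set T} (hI : IsBasicInterval α I) :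
    IsBranchInterval α I := by
  rcases hI with ⟨x, hx, rfl⟩ | ⟨-, hI, -⟩
  exacts [isBranchInterval_singleton hx, hI]

theorem IsBasicInterval.nonempty {α : T} {I : Set T} (hI : IsBasicInterval α I) : I.Nonempty := by
  rcases hI with ⟨x, hx, rfl⟩ | ⟨hI, -, -⟩
  exacts [Set.singleton_nonempty x, hI]

theorem IsBasicInterval.dense {α : T} {I : Set T} (hI : IsBasicInterval α I) :
    ∀ x ∈ I, ∀ y ∈ I, x < y → ∃ z ∈ I, x < z ∧ z < y := by
  rcases hI with ⟨x, hx, rfl⟩ | ⟨-, -, hI⟩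
  · rintro a rfl b rfl h
    exact absurd h (lt_irrefl _)
  · exact hI

/-! ### Finite unions of branch intervals -/

/-- The initial segments of the branch of `α` with an upper bound in the branch. -/
def IsInitialSegment (α : T) (A : Set T) : Prop :=
  ∃ b ≤ α, A = Set.Iic b ∨ A = Set.Iio b

/-- The final segments of the branch of `α` with a lower bound in `br(α) ∪ {-∞}`. -/
def IsFinalSegment (α : T) (A : Set T) : Prop :=
  A = Set.Iic α ∨ ∃ a ≤ α, A = Set.Icc a α ∨ A = Set.Ioc a α

/-- Two such segments of a chain are nested, so the union is one of them; final segments behave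
alike. -/
theorem IsInitialSegment.union (hT : BranchesAreChains T) {α : T} {A B : Set T}
    (hA : IsInitialSegment α A) (hB : IsInitialSegment α B) : IsInitialSegment α (A ∪ B) := by
  suffices h : A ⊆ B ∨ B ⊆ A by
    rcases h with h | h
    · rwa [Set.union_eq_right.2 h]
    · rwa [Set.union_eq_left.2 h]
  obtain ⟨a, ha, hA⟩ := hA
  obtain ⟨b, hb, hB⟩ := hB
  rcases eq_or_ne a b with rfl | hne
  · rcases hA with rfl | rfl <;> rcases hB with rfl | rfl
    · exact Or.inl le_rfl
    · exact Or.inr Set.Iio_subset_Iic_self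
    · exact Or.inl Set.Iio_subset_Iic_self
    · exact Or.inl le_rfl
  have key : ∀ {a b : T} {A B : Set T}, (A = Set.Iic a ∨ A = Set.Iio a) →
      (B = Set.Iic b ∨ B = Set.Iio b) → a < b → A ⊆ B := by
    intro a b A B hA hB hab x hx
    have hxa : x ≤ a := by
      rcases hA with rfl | rfl
      exacts [hx, le_of_lt hx]
    rcases hB with rfl | rfl
    exacts [hxa.trans hab.le, hxa.trans_lt hab]
  rcases hT α a b ha hb with h | h
  · exact Or.inl (key hA hB (lt_of_le_of_ne h hne))
  · exact Or.inr (key hB hA (lt_of_le_of_ne h hne.symm))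

theorem IsFinalSegment.union (hT : BranchesAreChains T) {α : T} {A B : Set T}
    (hA : IsFinalSegment α A) (hB : IsFinalSegment α B) : IsFinalSegment α (A ∪ B) := by
  suffices h : A ⊆ B ∨ B ⊆ A by
    rcases h with h | h
    · rwa [Set.union_eq_right.2 h]
    · rwa [Set.union_eq_left.2 h]
  have hsub : ∀ {A : Set T}, IsFinalSegment α A → A ⊆ Set.Iic α := by
    rintro A (rfl | ⟨a, -, rfl | rfl⟩)
    exacts [le_rfl, fun x hx => hx.2, fun x hx => hx.2]
  rcases hA with rfl | ⟨a, ha, hA⟩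
  · exact Or.inr (hsub hB)
  rcases hB with rfl | ⟨b, hb, hB⟩
  · exact Or.inl (hsub (Or.inr ⟨a, ha, hA⟩))
  rcases eq_or_ne a b with rfl | hne
  · rcases hA with rfl | rfl <;> rcases hB with rfl | rfl
    · exact Or.inl le_rfl
    · exact Or.inr Set.Ioc_subset_Icc_self
    · exact Or.inl Set.Ioc_subset_Icc_self
    · exact Or.inl le_rfl
  have key : ∀ {a b : T} {A B : Set T}, (A = Set.Icc a α ∨ A = Set.Ioc a α) →
      (B = Set.Icc b α ∨ B = Set.Ioc b α) → b < a → A ⊆ B := by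
    intro a b A B hA hB hab x hx
    have hxa : a ≤ x ∧ x ≤ α := by
      rcases hA with rfl | rfl
      exacts [hx, ⟨hx.1.le, hx.2⟩]
    rcases hB with rfl | rfl
    exacts [⟨hab.le.trans hxa.1, hxa.2⟩, ⟨hab.trans_le hxa.1, hxa.2⟩]
  rcases hT α a b ha hb with h | h
  · exact Or.inr (key hB hA (lt_of_le_of_ne h hne))
  · exact Or.inl (key hA hB (lt_of_le_of_ne h hne.symm))

theorem IsBranchInterval.isInitialSegment (hT : BranchesAreChains T) {α : T} {I : Set T}
    (hI : IsBranchInterval α I) (hne : I.Nonempty) : IsInitialSegment α {z | ∃ s ∈ I, z ≤ s} := by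
  obtain ⟨x, hx⟩ := hne
  rcases hI with ⟨a, ha, b, hb, rfl | rfl | rfl | rfl⟩ | ⟨b, hb, rfl | rfl⟩
  · exact ⟨b, hb, Or.inl (Set.Subset.antisymm (fun z ⟨s, hs, hz⟩ => hz.trans hs.2)
      fun z hz => ⟨b, ⟨hx.1.trans hx.2, le_rfl⟩, hz⟩)⟩
  · refine ⟨b, hb, Or.inr (Set.Subset.antisymm (fun z ⟨s, hs, hz⟩ => hz.trans_lt hs.2)
      fun z hz => ?_)⟩
    rcases hT α z x ((le_of_lt hz).trans hb) (hx.2.le.trans hb) with h | h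
    · exact ⟨x, hx, h⟩
    · exact ⟨z, ⟨hx.1.trans h, hz⟩, le_rfl⟩
  · exact ⟨b, hb, Or.inl (Set.Subset.antisymm (fun z ⟨s, hs, hz⟩ => hz.trans hs.2)
      fun z hz => ⟨b, ⟨hx.1.trans_le hx.2, le_rfl⟩, hz⟩)⟩
  · refine ⟨b, hb, Or.inr (Set.Subset.antisymm (fun z ⟨s, hs, hz⟩ => hz.trans_lt hs.2)
      fun z hz => ?_)⟩
    rcases hT α z x ((le_of_lt hz).trans hb) (hx.2.le.trans hb) with h | h
    · exact ⟨x, hx, h⟩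
    · exact ⟨z, ⟨hx.1.trans_le h, hz⟩, le_rfl⟩
  · exact ⟨b, hb, Or.inl (Set.Subset.antisymm (fun z ⟨s, hs, hz⟩ => hz.trans hs)
      fun z hz => ⟨z, hz, le_rfl⟩)⟩
  · exact ⟨b, hb, Or.inr (Set.Subset.antisymm (fun z ⟨s, hs, hz⟩ => hz.trans_lt hs)
      fun z hz => ⟨z, hz, le_rfl⟩)⟩

theorem IsBranchInterval.isFinalSegment (hT : BranchesAreChains T) {α : T} {I : Set T}
    (hI : IsBranchInterval α I) (hne : I.Nonempty) :
    IsFinalSegment α {z | z ≤ α ∧ ∃ s ∈ I, s ≤ z} := by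
  have hsub := hI.subset_Iic
  obtain ⟨x, hx⟩ := hne
  have hxα : x ≤ α := hsub hx
  rcases hI with ⟨a, ha, b, hb, h⟩ | ⟨b, hb, h⟩
  · by_cases haI : a ∈ I
    · refine Or.inr ⟨a, ha, Or.inl (Set.Subset.antisymm ?_ fun z hz => ⟨hz.2, a, haI, hz.1⟩)⟩
      rintro z ⟨hz, s, hs, hsz⟩
      refine ⟨le_trans ?_ hsz, hz⟩
      rcases h with rfl | rfl | rfl | rfl
      exacts [hs.1, hs.1, hs.1.le, hs.1.le]
    -- Whether `a` belongs to `I` decides between `Icc a α` and `Ioc a α`.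
    · have hlt : ∀ s ∈ I, a < s := by
        intro s hs
        refine lt_of_le_of_ne ?_ (fun h => haI (h ▸ hs))
        rcases h with rfl | rfl | rfl | rfl
        exacts [hs.1, hs.1, hs.1.le, hs.1.le]
      refine Or.inr ⟨a, ha, Or.inr (Set.Subset.antisymm ?_ fun z hz => ⟨hz.2, ?_⟩)⟩
      · rintro z ⟨hz, s, hs, hsz⟩
        exact ⟨(hlt s hs).trans_le hsz, hz⟩
      · rcases hT α z x hz.2 hxα with h' | h'
        · refine ⟨z, ?_, le_rfl⟩
          rcases h with rfl | rfl | rfl | rfl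
          · exact ⟨hz.1.le, h'.trans hx.2⟩
          · exact ⟨hz.1.le, h'.trans_lt hx.2⟩
          · exact ⟨hz.1, h'.trans hx.2⟩
          · exact ⟨hz.1, h'.trans_lt hx.2⟩
        · exact ⟨x, hx, h'⟩
  · refine Or.inl (Set.Subset.antisymm (fun z hz => hz.1) fun z hz => ⟨hz, ?_⟩)
    rcases hT α z x hz hxα with h' | h'
    · refine ⟨z, ?_, le_rfl⟩
      rcases h with rfl | rfl
      exacts [h'.trans hx, h'.trans_lt hx]
    · exact ⟨x, hx, h'⟩

/-- A convex finite union of branch intervals is a branch interval. -/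
theorem isBranchInterval_sUnion (hT : BranchesAreChains T) {α : T} {F : Set (Set T)}
    (hF : F.Finite) (hFI : ∀ I ∈ F, IsBranchInterval α I) (hne : (⋃₀ F).Nonempty)
    (hconv : (⋃₀ F).OrdConnected) : IsBranchInterval α (⋃₀ F) := by
  have hinit : IsInitialSegment α {z | ∃ s ∈ ⋃₀ F, z ≤ s} ∧
      IsFinalSegment α {z | z ≤ α ∧ ∃ s ∈ ⋃₀ F, s ≤ z} := by
    -- Convexity does not pass to subfamilies; the induction on downward and upward closures does
    -- without it.
    clear hconv
    induction F, hF using Set.Finite.induction_on with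
    | empty => simp at hne
    | @insert I F hI hF ih =>
      rw [Set.forall_mem_insert] at hFI
      rw [Set.sUnion_insert] at hne ⊢
      rcases I.eq_empty_or_nonempty with rfl | hIne
      · simp only [Set.empty_union] at hne ⊢
        exact ih hFI.2 hne
      have h1 := hFI.1.isInitialSegment hT hIne
      have h2 := hFI.1.isFinalSegment hT hIne
      rcases (⋃₀ F).eq_empty_or_nonempty with hFe | hFne
      · rw [hFe, Set.union_empty]
        exact ⟨h1, h2⟩
      obtain ⟨h3, h4⟩ := ih hFI.2 hFne
      constructor
      · convert h1.union hT h3 using 1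
        ext z
        simp only [Set.mem_union, Set.mem_ofPred_eq, or_and_right, exists_or]
      · convert h2.union hT h4 using 1
        ext z
        simp only [Set.mem_union, Set.mem_ofPred_eq, or_and_right, exists_or, and_or_left]
  -- A convex subset of the branch is the intersection of its downward closure and its upward
  -- closure in the branch.
  have hS : ⋃₀ F = {z | ∃ s ∈ ⋃₀ F, z ≤ s} ∩ {z | z ≤ α ∧ ∃ s ∈ ⋃₀ F, s ≤ z} := by
    ext z
    constructor
    · intro hz
      have hzα : z ≤ α := by
        obtain ⟨I, hI, hzI⟩ := hz
        exact (hFI I hI).subset_Iic hzI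
      exact ⟨⟨z, hz, le_rfl⟩, hzα, z, hz, le_rfl⟩
    · rintro ⟨⟨s, hs, hzs⟩, -, t, ht, htz⟩
      exact hconv.out ht hs ⟨htz, hzs⟩
  obtain ⟨⟨b, hb, h1⟩, h2⟩ := hinit
  rw [hS]
  rcases h1 with h1 | h1 <;> rcases h2 with h2 | ⟨a, ha, h2 | h2⟩ <;> rw [h1, h2]
  · exact Or.inr ⟨b, hb, Or.inl (Set.inter_eq_left.2 (Set.Iic_subset_Iic.2 hb))⟩
  · refine Or.inl ⟨a, ha, b, hb, Or.inl ?_⟩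
    ext z
    exact ⟨fun h => ⟨h.2.1, h.1⟩, fun h => ⟨h.2, h.1, le_trans h.2 hb⟩⟩
  · refine Or.inl ⟨a, ha, b, hb, Or.inr (Or.inr (Or.inl ?_))⟩
    ext z
    exact ⟨fun h => ⟨h.2.1, h.1⟩, fun h => ⟨h.2, h.1, le_trans h.2 hb⟩⟩
  · exact Or.inr ⟨b, hb, Or.inr (Set.inter_eq_left.2 fun z hz => (le_of_lt hz).trans hb)⟩
  · refine Or.inl ⟨a, ha, b, hb, Or.inr (Or.inl ?_)⟩
    ext z
    exact ⟨fun h => ⟨h.2.1, h.1⟩, fun h => ⟨h.2, h.1, (le_of_lt h.2).trans hb⟩⟩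
  · refine Or.inl ⟨a, ha, b, hb, Or.inr (Or.inr (Or.inr ?_))⟩
    ext z
    exact ⟨fun h => ⟨h.2.1, h.1⟩, fun h => ⟨h.2, h.1, (le_of_lt h.2).trans hb⟩⟩

/-! ### The relation of lying in a common dense one-typed interval -/

/-- A densely ordered set whose elements have the same type. -/
def IsDenseOneTyped (L : Language) [L.Structure T] (S : Set T) : Prop :=
  (∀ x ∈ S, ∀ y ∈ S, SameType L x y) ∧ ∀ x ∈ S, ∀ y ∈ S, x < y → ∃ z ∈ S, x < z ∧ z < y

/-- `x` and `y` bound a dense one-typed interval. -/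
def Linked (L : Language) [L.Structure T] (x y : T) : Prop :=
  IsDenseOneTyped L (Set.Icc x y) ∧ IsDenseOneTyped L (Set.Icc y x)

variable {L : Language} [L.Structure T]

theorem IsDenseOneTyped.mono {S S' : Set T} (h : IsDenseOneTyped L S) (hS : S' ⊆ S)
    (hc : S'.OrdConnected) : IsDenseOneTyped L S' := by
  refine ⟨fun x hx y hy => h.1 x (hS hx) y (hS hy), fun x hx y hy hxy => ?_⟩
  obtain ⟨z, -, hz⟩ := h.2 x (hS hx) y (hS hy) hxy
  exact ⟨z, hc.out hx hy ⟨hz.1.le, hz.2.le⟩, hz⟩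

/-- When `x ≤ y ≤ z`, the two intervals share `y`, which carries the common type and separates
points on its two sides. Otherwise `Icc x z` is contained in one of them. -/
theorem IsDenseOneTyped.trans (hT : BranchesAreChains T) {α x y z : T} (hx : x ≤ α) (hy : y ≤ α)
    (hz : z ≤ α) (hxy : IsDenseOneTyped L (Set.Icc x y)) (hyz : IsDenseOneTyped L (Set.Icc y z)) :
    IsDenseOneTyped L (Set.Icc x z) := by
  rcases hT α x y hx hy with h1 | h1
  swap
  · exact hyz.mono (Set.Icc_subset_Icc_left h1) Set.ordConnected_Icc
  rcases hT α y z hy hz with h2 | h2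
  swap
  · exact hxy.mono (Set.Icc_subset_Icc_right h2) Set.ordConnected_Icc
  have hcmp : ∀ u ∈ Set.Icc x z, u ∈ Set.Icc x y ∨ u ∈ Set.Icc y z := fun u hu =>
    (hT z u y hu.2 h2).imp (fun h => ⟨hu.1, h⟩) (fun h => ⟨h, hu.2⟩)
  have htype : ∀ u ∈ Set.Icc x z, SameType L u y := by
    intro u hu
    rcases hcmp u hu with h | h
    · exact hxy.1 u h y ⟨h1, le_rfl⟩
    · exact hyz.1 u h y ⟨le_rfl, h2⟩
  refine ⟨fun u hu v hv => (htype u hu).trans (htype v hv).symm, fun u hu v hv huv => ?_⟩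
  rcases hcmp u hu with hu' | hu'
  · rcases hcmp v hv with hv' | hv'
    · obtain ⟨w, hw, hw'⟩ := hxy.2 u hu' v hv' huv
      exact ⟨w, ⟨hw.1, hw.2.trans h2⟩, hw'⟩
    · rcases hu'.2.eq_or_lt with rfl | huy
      · obtain ⟨w, hw, hw'⟩ := hyz.2 u ⟨le_rfl, h2⟩ v hv' huv
        exact ⟨w, ⟨h1.trans hw.1, hw.2⟩, hw'⟩
      · rcases hv'.1.eq_or_lt with rfl | hyv
        · obtain ⟨w, hw, hw'⟩ := hxy.2 u hu' y ⟨h1, le_rfl⟩ huv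
          exact ⟨w, ⟨hw.1, hw.2.trans h2⟩, hw'⟩
        · exact ⟨y, ⟨h1, h2⟩, huy, hyv⟩
  · obtain ⟨w, hw, hw'⟩ := hyz.2 u hu' v ⟨hu'.1.trans huv.le, hv.2⟩ huv
    exact ⟨w, ⟨h1.trans hw.1, hw.2⟩, hw'⟩

theorem isDenseOneTyped_of_subsingleton {S : Set T} (hS : S.Subsingleton) :
    IsDenseOneTyped L S := by
  refine ⟨fun x hx y hy => ?_, fun x hx y hy hxy => absurd (hS hx hy) hxy.ne⟩
  rw [hS hx hy]
  exact SameType.refl y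

theorem Icc_subsingleton_of_le {x y : T} (h : y ≤ x) : (Set.Icc x y).Subsingleton :=
  fun _ ha _ hb => (le_antisymm (ha.2.trans h) ha.1).trans (le_antisymm (hb.2.trans h) hb.1).symm

theorem linked_of_isDenseOneTyped {x y : T} (hxy : x ≤ y)
    (h : IsDenseOneTyped L (Set.Icc x y)) : Linked L x y :=
  ⟨h, isDenseOneTyped_of_subsingleton (Icc_subsingleton_of_le hxy)⟩

theorem Linked.refl (x : T) : Linked L x x :=
  linked_of_isDenseOneTyped le_rfl (isDenseOneTyped_of_subsingleton (Icc_subsingleton_of_le le_rfl))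

theorem Linked.symm {x y : T} (h : Linked L x y) : Linked L y x :=
  ⟨h.2, h.1⟩

theorem Linked.trans (hT : BranchesAreChains T) {α x y z : T} (hx : x ≤ α) (hy : y ≤ α)
    (hz : z ≤ α) (hxy : Linked L x y) (hyz : Linked L y z) : Linked L x z :=
  ⟨hxy.1.trans hT hx hy hz hyz.1, hyz.2.trans hT hz hy hx hxy.2⟩

theorem IsDenseOneTyped.linked {S : Set T} (h : IsDenseOneTyped L S) (hS : S.OrdConnected) {x y : T}
    (hx : x ∈ S) (hy : y ∈ S) : Linked L x y :=
  ⟨h.mono (hS.out hx hy) Set.ordConnected_Icc, h.mono (hS.out hy hx) Set.ordConnected_Icc⟩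

theorem Linked.of_le_of_le {x y u v : T} (h : Linked L x y) (hxu : x ≤ u) (huv : u ≤ v)
    (hvy : v ≤ y) : Linked L u v :=
  linked_of_isDenseOneTyped huv (h.1.mono (Set.Icc_subset_Icc hxu hvy) Set.ordConnected_Icc)

theorem Linked.sameType (hT : BranchesAreChains T) {α x y : T} (hx : x ≤ α) (hy : y ≤ α)
    (h : Linked L x y) : SameType L x y := by
  rcases hT α x y hx hy with hxy | hxy
  · exact h.1.1 x ⟨le_rfl, hxy⟩ y ⟨hxy, le_rfl⟩
  · exact h.2.1 x ⟨hxy, le_rfl⟩ y ⟨le_rfl, hxy⟩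

theorem Linked.exists_between {x y : T} (h : Linked L x y) (hxy : x < y) : ∃ z, x < z ∧ z < y := by
  obtain ⟨z, -, hz⟩ := h.1.2 x ⟨le_rfl, hxy.le⟩ y ⟨hxy.le, le_rfl⟩ hxy
  exact ⟨z, hz⟩

theorem IsBasicOneTyped.linked {α : T} {I : Set T} (hI : IsBasicOneTyped L α I) {x y : T}
    (hx : x ∈ I) (hy : y ∈ I) : Linked L x y :=
  IsDenseOneTyped.linked ⟨hI.2, hI.1.dense⟩ hI.1.isBranchInterval.ordConnected hx hy

/-- A branch interval of pairwise linked elements is a basic one-typed interval. -/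
theorem isBasicOneTyped_of_linked (hT : BranchesAreChains T) {α : T} {I : Set T}
    (hne : I.Nonempty) (hI : IsBranchInterval α I) (h : ∀ x ∈ I, ∀ y ∈ I, Linked L x y) :
    IsBasicOneTyped L α I := by
  refine ⟨Or.inr ⟨hne, hI, fun x hx y hy hxy => ?_⟩, fun x hx y hy =>
    (h x hx y hy).sameType hT (hI.subset_Iic hx) (hI.subset_Iic hy)⟩
  obtain ⟨z, hxz, hzy⟩ := (h x hx y hy).exists_between hxy
  exact ⟨z, hI.ordConnected.out hx hy ⟨hxz.le, hzy.le⟩, hxz, hzy⟩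

/-! ### Uniqueness of maximal decompositions -/

theorem IsDecomposition.lt_leaf {α : T} {n : ℕ} {I : Fin n → Set T}
    (hI : IsDecomposition L α I) {j : Fin n} {x : T} (hx : x ∈ I j) : x < α :=
  lt_of_le_of_ne ((hI.oneTyped j).1.isBranchInterval.subset_Iic hx)
    fun h => hI.notMem j (h ▸ hx)

theorem IsDecomposition.exists_mem {α : T} {n : ℕ} {I : Fin n → Set T}
    (hI : IsDecomposition L α I) {x : T} (hx : x < α) : ∃ j, x ∈ I j := by
  have : x ∈ (⋃ j, I j) ∪ {α} := hI.union ▸ hx.le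
  rcases this with h | h
  · exact Set.mem_iUnion.1 h
  · exact absurd h hx.ne

theorem IsDecomposition.le_of_le {α : T} {n : ℕ} {I : Fin n → Set T}
    (hI : IsDecomposition L α I) {i j : Fin n} {x y : T} (hx : x ∈ I i) (hy : y ∈ I j)
    (hxy : x ≤ y) : i ≤ j :=
  not_lt.1 fun h => (hI.lt j i h y hy x hx).not_ge hxy

/-- Links pass to subintervals, so a link from `I i` to a later piece gives one from `I i` to the
next piece. Transitivity then makes these two consecutive pieces a single basic one-typed interval,
against maximality. -/
theorem IsMaximalDecomposition.eq_of_linked (hT : BranchesAreChains T) {α : T} {n : ℕ}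
    {I : Fin n → Set T} (hI : IsMaximalDecomposition L α I) {i j : Fin n} {x y : T}
    (hx : x ∈ I i) (hy : y ∈ I j) (h : Linked L x y) : i = j := by
  have hD := hI.toIsDecomposition
  wlog hij : i < j generalizing i j x y
  · rcases (not_lt.1 hij).eq_or_lt with h' | h'
    · exact h'.symm
    · exact (this hy hx h.symm h').symm
  exfalso
  obtain ⟨k, hk⟩ : ∃ k : Fin n, (i : ℕ) + 1 = k := ⟨⟨i + 1, by omega⟩, rfl⟩
  have hik : i < k := Fin.lt_def.2 (by omega)
  have hkj : k ≤ j := Fin.le_def.2 (by rw [← hk]; exact hij)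
  obtain ⟨y', hy', hy'y⟩ : ∃ y' ∈ I k, y' ≤ y := by
    rcases hkj.eq_or_lt with rfl | hkj
    · exact ⟨y, hy, le_rfl⟩
    · obtain ⟨y', hy'⟩ := (hD.oneTyped k).1.nonempty
      exact ⟨y', hy', (hD.lt k j hkj y' hy' y hy).le⟩
  have hxy' : Linked L x y' := h.of_le_of_le le_rfl (hD.lt i k hik x hx y' hy').le hy'y
  have hle : ∀ {l : Fin n} {u : T}, u ∈ I l → u ≤ α := fun hu => (hD.lt_leaf hu).le
  have hcross : ∀ u ∈ I i, ∀ v ∈ I k, Linked L u v := fun u hu v hv =>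
    (((hD.oneTyped i).linked hu hx).trans hT (hle hu) (hle hx) (hle hy') hxy').trans hT
      (hle hu) (hle hy') (hle hv) ((hD.oneTyped k).linked hy' hv)
  refine hI.maximal i k hk (isBasicOneTyped_of_linked hT ⟨x, Or.inl hx⟩ ?_ ?_)
  · rw [← Set.sUnion_pair]
    refine isBranchInterval_sUnion hT (Set.toFinite _) ?_ ⟨x, by simp [hx]⟩ ?_
    · rintro J (rfl | rfl)
      exacts [(hD.oneTyped i).1.isBranchInterval, (hD.oneTyped k).1.isBranchInterval]
    · rw [Set.sUnion_pair]
      have hidx : ∀ {u}, u ∈ I i ∪ I k → ∃ l, u ∈ I l ∧ i ≤ l ∧ l ≤ k := by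
        rintro u (hu | hu)
        exacts [⟨i, hu, le_rfl, hik.le⟩, ⟨k, hu, hik.le, le_rfl⟩]
      refine ⟨fun u hu v hv w hw => ?_⟩
      obtain ⟨l, hul, hl, -⟩ := hidx hu
      obtain ⟨m, hvm, -, hm⟩ := hidx hv
      obtain ⟨p, hp⟩ := hD.exists_mem (hw.2.trans_lt (hD.lt_leaf hvm))
      have h1 := hl.trans (hD.le_of_le hul hp hw.1)
      have h2 := (hD.le_of_le hp hvm hw.2).trans hm
      rw [Fin.le_def] at h1 h2
      rcases (show p = i ∨ p = k by simp only [Fin.ext_iff]; omega) with rfl | rfl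
      exacts [Or.inl hp, Or.inr hp]
  · rintro u (hu | hu) v (hv | hv)
    · exact (hD.oneTyped i).linked hu hv
    · exact hcross u hu v hv
    · exact (hcross v hv u hu).symm
    · exact (hD.oneTyped k).linked hu hv

theorem IsMaximalDecomposition.linked_iff (hT : BranchesAreChains T) {α : T} {n : ℕ}
    {I : Fin n → Set T} (hI : IsMaximalDecomposition L α I) {i j : Fin n} {x y : T}
    (hx : x ∈ I i) (hy : y ∈ I j) : Linked L x y ↔ i = j :=
  ⟨hI.eq_of_linked hT hx hy, by rintro rfl; exact (hI.oneTyped i).linked hx hy⟩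

theorem IsMaximalDecomposition.mem_iff (hT : BranchesAreChains T) {α : T} {n : ℕ}
    {I : Fin n → Set T} (hI : IsMaximalDecomposition L α I) {i : Fin n} {x : T}
    (hx : x ∈ I i) (z : T) : z ∈ I i ↔ z < α ∧ Linked L x z := by
  constructor
  · exact fun hz => ⟨hI.lt_leaf hz, (hI.linked_iff hT hx hz).2 rfl⟩
  · rintro ⟨hz, hxz⟩
    obtain ⟨j, hj⟩ := hI.exists_mem hz
    rwa [hI.eq_of_linked hT hx hj hxz]

/-- By `mem_iff`, a piece is the set of elements below `α` linked to any one of its points, which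
does not refer to the decomposition. Both decompositions thus list the same sets in increasing
order. -/
theorem IsMaximalDecomposition.unique (hT : BranchesAreChains T) {α : T} {n m : ℕ}
    {I : Fin n → Set T} {J : Fin m → Set T} (hI : IsMaximalDecomposition L α I)
    (hJ : IsMaximalDecomposition L α J) : ∃ e : m = n, ∀ j, J j = I (Fin.cast e j) := by
  have hex : ∀ {m n : ℕ} {J : Fin m → Set T} {I : Fin n → Set T},
      IsMaximalDecomposition L α J → IsMaximalDecomposition L α I →
        ∃ σ : Fin m → Fin n, StrictMono σ ∧ ∀ j, J j = I (σ j) := by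
    intro m n J I hJ hI
    have : ∀ j, ∃ i, J j = I i := by
      intro j
      obtain ⟨x, hx⟩ := (hJ.oneTyped j).1.nonempty
      obtain ⟨i, hi⟩ := hI.exists_mem (hJ.lt_leaf hx)
      exact ⟨i, Set.ext fun z => (hJ.mem_iff hT hx z).trans (hI.mem_iff hT hi z).symm⟩
    choose σ hσ using this
    refine ⟨σ, fun j k hjk => ?_, hσ⟩
    obtain ⟨x, hx⟩ := (hJ.oneTyped j).1.nonempty
    obtain ⟨y, hy⟩ := (hJ.oneTyped k).1.nonempty
    have hxy := hJ.lt j k hjk x hx y hy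
    have hxI : x ∈ I (σ j) := hσ j ▸ hx
    have hyI : y ∈ I (σ k) := hσ k ▸ hy
    refine lt_of_le_of_ne (hI.le_of_le hxI hyI hxy.le) fun h => ?_
    rw [h, ← hσ k] at hxI
    exact (hJ.le_of_le hxI hx le_rfl).not_gt hjk
  obtain ⟨σ, hσ, hσI⟩ := hex hJ hI
  obtain ⟨τ, hτ, -⟩ := hex hI hJ
  have e : m = n := by
    have h1 := Fintype.card_le_of_injective σ hσ.injective
    have h2 := Fintype.card_le_of_injective τ hτ.injective
    simp only [Fintype.card_fin] at h1 h2
    omega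
  subst e
  refine ⟨rfl, fun j => ?_⟩
  have hid : σ = id := (hσ.range_inj strictMono_id).1 (by
    rw [Set.range_id, (Finite.injective_iff_surjective.1 hσ.injective).range_eq])
  rw [hσI, hid]
  rfl

end Branches

section Existence

variable {T : Type*} [PartialOrder T] {L : Language} [L.Structure T]

/-! ### Existence of maximal decompositions -/

/-- The elements of `br(α)` other than `α` that are linked to `x`. -/
def linkedClass (L : Language) [L.Structure T] (α x : T) : Set T :=
  {z | z < α ∧ Linked L x z}

theorem mem_linkedClass_self {α x : T} (hx : x < α) : x ∈ linkedClass L α x :=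
  ⟨hx, Linked.refl x⟩

theorem linked_of_mem_linkedClass (hT : BranchesAreChains T) {α x y z : T} (hx : x < α)
    (hy : y ∈ linkedClass L α x) (hz : z ∈ linkedClass L α x) : Linked L y z :=
  hy.2.symm.trans hT hy.1.le hx.le hz.1.le hz.2

theorem ordConnected_linkedClass (hT : BranchesAreChains T) {α x : T} (hx : x < α) :
    (linkedClass L α x).OrdConnected := by
  refine ⟨fun u hu v hv w hw => ?_⟩
  have hwα := hw.2.trans_lt hv.1
  exact ⟨hwα, hu.2.trans hT hx.le hu.1.le hwα.le
    ((linked_of_mem_linkedClass hT hx hu hv).of_le_of_le le_rfl hw.1 hw.2)⟩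

theorem linkedClass_eq_of_linked (hT : BranchesAreChains T) {α x y : T} (hx : x < α) (hy : y < α)
    (h : Linked L x y) : linkedClass L α x = linkedClass L α y :=
  Set.ext fun _ => and_congr_right fun hz =>
    ⟨fun h' => h.symm.trans hT hy.le hx.le hz.le h', fun h' => h.trans hT hx.le hy.le hz.le h'⟩

/-- A member of `F` meeting a class lies inside it. This gives both the finiteness of the number of
classes and the fact that each is an interval. -/
theorem linkedClass_eq_sUnion (hT : BranchesAreChains T) {α x : T} (hx : x < α) {F : Set (Set T)}
    (hlink : ∀ I ∈ F, ∀ x ∈ I, ∀ y ∈ I, Linked L x y) (hcov : ⋃₀ F = Set.Iio α) :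
    ⋃₀ {I ∈ F | I ⊆ linkedClass L α x} = linkedClass L α x := by
  refine Set.Subset.antisymm (Set.sUnion_subset fun I hI => hI.2) fun z hz => ?_
  obtain ⟨I, hI, hzI⟩ : z ∈ ⋃₀ F := hcov ▸ hz.1
  refine ⟨I, ⟨hI, fun w hw => ?_⟩, hzI⟩
  have hwα : w < α := by
    have : w ∈ ⋃₀ F := ⟨I, hI, hw⟩
    rwa [hcov] at this
  exact ⟨hwα, hz.2.trans hT hx.le hz.1.le hwα.le (hlink I hI z hzI w hw)⟩

theorem exists_strictMono_range_eq (hT : BranchesAreChains T) {α : T} {R : Set T} (hR : R.Finite)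
    (hRα : R ⊆ Set.Iic α) : ∃ (n : ℕ) (f : Fin n → T), StrictMono f ∧ Set.range f = R := by
  classical
  have := hR.fintype
  let : LinearOrder R :=
    { (inferInstance : PartialOrder R) with
      le_total := fun x y => hT α x y (hRα x.2) (hRα y.2)
      toDecidableLE := Classical.decRel _ }
  let e := monoEquivOfFin R rfl
  refine ⟨Fintype.card R, fun i => e i, fun i j hij => e.strictMono hij, ?_⟩
  ext x
  exact ⟨by rintro ⟨i, rfl⟩; exact (e i).2, fun hx => ⟨e.symm ⟨x, hx⟩, by simp⟩⟩

/-- A branch covered by finitely many intervals of linked elements has a maximal decomposition. -/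
theorem exists_isMaximalDecomposition (hT : BranchesAreChains T) {α : T} {F : Set (Set T)}
    (hF : F.Finite) (hFI : ∀ I ∈ F, IsBranchInterval α I)
    (hlink : ∀ I ∈ F, ∀ x ∈ I, ∀ y ∈ I, Linked L x y) (hcov : ⋃₀ F = Set.Iio α) :
    ∃ (n : ℕ) (I : Fin n → Set T), IsMaximalDecomposition L α I := by
  have hfin : (linkedClass L α '' Set.Iio α).Finite := by
    refine (hF.finite_subsets.image Set.sUnion).subset ?_
    rintro _ ⟨x, hx, rfl⟩
    exact ⟨_, fun I hI => hI.1, linkedClass_eq_sUnion hT hx hlink hcov⟩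
  have hsec : ∀ K : linkedClass L α '' Set.Iio α, ∃ x, x < α ∧ linkedClass L α x = K :=
    fun K => K.2
  choose r hr hrK using hsec
  have : Finite (linkedClass L α '' Set.Iio α) := hfin
  -- One representative of each class, listed in increasing order.
  obtain ⟨n, f, hf, hfr⟩ := exists_strictMono_range_eq hT (Set.finite_range r)
    (α := α) (by rintro _ ⟨K, rfl⟩; exact (hr K).le)
  have hfα : ∀ j, f j < α := fun j => by
    obtain ⟨K, hK⟩ : f j ∈ Set.range r := hfr ▸ ⟨j, rfl⟩
    exact hK ▸ hr K
  have hinj : ∀ i j, Linked L (f i) (f j) → i = j := by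
    intro i j h
    obtain ⟨K, hK⟩ : f i ∈ Set.range r := hfr ▸ ⟨i, rfl⟩
    obtain ⟨K', hK'⟩ : f j ∈ Set.range r := hfr ▸ ⟨j, rfl⟩
    have := linkedClass_eq_of_linked hT (hfα i) (hfα j) h
    rw [← hK, ← hK', hrK, hrK] at this
    have := Subtype.ext this
    subst this
    exact hf.injective (hK.symm.trans hK')
  have hcmp : ∀ i j, ∀ x ∈ linkedClass L α (f i), ∀ y ∈ linkedClass L α (f j), Linked L x y →
      i = j := fun i j x hx y hy h => hinj i j
    ((hx.2.trans hT (hfα i).le hx.1.le hy.1.le h).trans hT (hfα i).le hy.1.le (hfα j).le hy.2.symm)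
  have hint : ∀ j, IsBranchInterval α (linkedClass L α (f j)) := by
    intro j
    have heq := linkedClass_eq_sUnion hT (hfα j) hlink hcov
    rw [← heq]
    refine isBranchInterval_sUnion hT (hF.subset fun I hI => hI.1) (fun I hI => hFI I hI.1) ?_ ?_
    · rw [heq]
      exact ⟨_, mem_linkedClass_self (hfα j)⟩
    · rw [heq]
      exact ordConnected_linkedClass hT (hfα j)
  refine ⟨n, fun j => linkedClass L α (f j), ⟨⟨fun j => ?_, ?_, ?_, ?_⟩, ?_⟩⟩
  · exact isBasicOneTyped_of_linked hT ⟨_, mem_linkedClass_self (hfα j)⟩ (hint j)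
      fun x hx y hy => linked_of_mem_linkedClass hT (hfα j) hx hy
  · intro i j hij x hx y hy
    by_contra hxy
    have hyx : y ≤ x := by
      rcases hT α x y hx.1.le hy.1.le with h | h
      · rcases h.eq_or_lt with rfl | h
        exacts [le_rfl, absurd h hxy]
      · exact h
    -- If `y ≤ x`, the order `f i < f j` and convexity put either `f i` in the class of `f j` or `y`
    -- in the class of `f i`.
    rcases hT α y (f i) hy.1.le (hfα i).le with h | h
    · have : f i ∈ linkedClass L α (f j) := (ordConnected_linkedClass hT (hfα j)).out hy
        (mem_linkedClass_self (hfα j)) ⟨h, (hf hij).le⟩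
      exact hij.ne (hinj i j this.2.symm)
    · have : y ∈ linkedClass L α (f i) := (ordConnected_linkedClass hT (hfα i)).out
        (mem_linkedClass_self (hfα i)) hx ⟨h, hyx⟩
      exact hij.ne (hcmp i j y this y hy (Linked.refl y))
  · exact fun j hj => lt_irrefl _ hj.1
  · ext x
    simp only [Set.mem_union, Set.mem_iUnion, Set.mem_singleton_iff, Set.mem_Iic]
    constructor
    · rintro (⟨j, hj⟩ | rfl)
      exacts [hj.1.le, le_rfl]
    · intro hx
      rcases hx.eq_or_lt with rfl | hx
      · exact Or.inr rfl
      left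
      obtain ⟨j, hj⟩ : r ⟨linkedClass L α x, x, hx, rfl⟩ ∈ Set.range f := hfr ▸ ⟨_, rfl⟩
      refine ⟨j, ?_⟩
      rw [hj, hrK]
      exact mem_linkedClass_self hx
  · intro i j hij h
    have := hinj i j (h.linked (Or.inl (mem_linkedClass_self (hfα i)))
      (Or.inr (mem_linkedClass_self (hfα j))))
    subst this
    omega

/-! ### Transport by automorphisms -/

variable {T' : Type*} [PartialOrder T'] [L.Structure T']

theorem IsBranchInterval.image (g : T ≃o T') {α : T} {I : Set T} (hI : IsBranchInterval α I) :
    IsBranchInterval (g α) (g '' I) := by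
  rcases hI with ⟨a, ha, b, hb, h⟩ | ⟨b, hb, h⟩
  · refine Or.inl ⟨g a, g.monotone ha, g b, g.monotone hb, ?_⟩
    rcases h with rfl | rfl | rfl | rfl <;> simp
  · refine Or.inr ⟨g b, g.monotone hb, ?_⟩
    rcases h with rfl | rfl <;> simp

theorem IsBasicInterval.image (g : T ≃o T') {α : T} {I : Set T} (hI : IsBasicInterval α I) :
    IsBasicInterval (g α) (g '' I) := by
  rcases hI with ⟨x, hx, rfl⟩ | ⟨hne, hI, hd⟩
  · exact Or.inl ⟨g x, g.monotone hx, by simp⟩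
  · refine Or.inr ⟨hne.image g, hI.image g, ?_⟩
    rintro _ ⟨x, hx, rfl⟩ _ ⟨y, hy, rfl⟩ hxy
    obtain ⟨z, hz, h1, h2⟩ := hd x hx y hy (g.lt_iff_lt.1 hxy)
    exact ⟨g z, ⟨z, hz, rfl⟩, g.lt_iff_lt.2 h1, g.lt_iff_lt.2 h2⟩

theorem IsBasicOneTyped.image (g : T ≃o T') (hg : ∀ x y, SameType L x y → SameType L (g x) (g y))
    {α : T} {I : Set T} (hI : IsBasicOneTyped L α I) : IsBasicOneTyped L (g α) (g '' I) := by
  refine ⟨hI.1.image g, ?_⟩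
  rintro _ ⟨x, hx, rfl⟩ _ ⟨y, hy, rfl⟩
  exact hg x y (hI.2 x hx y hy)

theorem IsMaximalDecomposition.image (g : T ≃o T')
    (hg : ∀ x y, SameType L (g x) (g y) ↔ SameType L x y)
    {α : T} {n : ℕ} {I : Fin n → Set T} (hI : IsMaximalDecomposition L α I) :
    IsMaximalDecomposition L (g α) fun j => g '' I j where
  oneTyped j := (hI.oneTyped j).image g fun x y => (hg x y).2
  lt i j hij := by
    rintro _ ⟨x, hx, rfl⟩ _ ⟨y, hy, rfl⟩
    exact g.strictMono (hI.lt i j hij x hx y hy)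
  notMem j := by
    rintro ⟨x, hx, hxα⟩
    exact hI.notMem j (g.injective hxα ▸ hx)
  union := by
    rw [← Set.image_iUnion, ← Set.image_singleton, ← Set.image_union, hI.union]
    simp
  maximal i j hij h := by
    refine hI.maximal i j hij ?_
    have := h.image g.symm (fun x y hxy => by
      rw [← hg]
      simpa using hxy)
    simpa [Set.image_union, Set.image_image] using this

theorem HasForm.image (g : T ≃o T') {α : T} {I : Set T} {F : IntervalForm} (h : HasForm α I F) :
    HasForm (g α) (g '' I) F := by
  have hmin : (∀ z ∈ I, ∃ w ∈ I, w < z) → ∀ z ∈ g '' I, ∃ w ∈ g '' I, w < z := by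
    rintro h _ ⟨z, hz, rfl⟩
    obtain ⟨w, hw, hwz⟩ := h z hz
    exact ⟨g w, ⟨w, hw, rfl⟩, g.lt_iff_lt.2 hwz⟩
  have hmax : (∀ z ∈ I, ∃ w ∈ I, z < w) → ∀ z ∈ g '' I, ∃ w ∈ g '' I, z < w := by
    rintro h _ ⟨z, hz, rfl⟩
    obtain ⟨w, hw, hwz⟩ := h z hz
    exact ⟨g w, ⟨w, hw, rfl⟩, g.lt_iff_lt.2 hwz⟩
  cases F with
  | singleton =>
    obtain ⟨x, hx, rfl⟩ := h
    exact ⟨g x, g.monotone hx, by simp⟩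
  | openOpen =>
    obtain ⟨hne, h1, h2, h3⟩ := h
    refine ⟨hne.image g, hmin h1, hmax h2, ?_⟩
    rcases h3 with ⟨x, hx, y, hy, hxy, rfl⟩ | ⟨y, hy, rfl⟩
    · exact Or.inl ⟨g x, g.monotone hx, g y, g.monotone hy, g.strictMono hxy, by simp⟩
    · exact Or.inr ⟨g y, g.monotone hy, by simp⟩
  | openClosed =>
    obtain ⟨hne, h1, h3⟩ := h
    refine ⟨hne.image g, hmin h1, ?_⟩
    rcases h3 with ⟨x, hx, y, hy, hxy, rfl⟩ | ⟨y, hy, rfl⟩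
    · exact Or.inl ⟨g x, g.monotone hx, g y, g.monotone hy, g.strictMono hxy, by simp⟩
    · exact Or.inr ⟨g y, g.monotone hy, by simp⟩

theorem Linked.image (g : T ≃o T') (hg : ∀ x y, SameType L (g x) (g y) ↔ SameType L x y) {x y : T}
    (h : Linked L x y) : Linked L (g x) (g y) := by
  have key : ∀ {x y : T}, IsDenseOneTyped L (Set.Icc x y) →
      IsDenseOneTyped L (Set.Icc (g x) (g y)) := by
    intro x y h
    rw [← g.image_Icc]
    constructor
    · rintro _ ⟨u, hu, rfl⟩ _ ⟨v, hv, rfl⟩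
      exact (hg u v).2 (h.1 u hu v hv)
    · rintro _ ⟨u, hu, rfl⟩ _ ⟨v, hv, rfl⟩ huv
      obtain ⟨w, hw, h1, h2⟩ := h.2 u hu v hv (g.lt_iff_lt.1 huv)
      exact ⟨g w, ⟨w, hw, rfl⟩, g.lt_iff_lt.2 h1, g.lt_iff_lt.2 h2⟩
  exact ⟨key h.1, key h.2⟩

/-! ### Forms of the intervals -/

/-- If elements of the same type are conjugate, an interval of a maximal decomposition with at least
two elements has no least element. -/
theorem IsMaximalDecomposition.exists_lt (hT : BranchesAreChains T)
    (hconj : ∀ x y : T, SameType L x y → ∃ g : T ≃o T,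
      (∀ x y, SameType L (g x) (g y) ↔ SameType L x y) ∧ g x = y)
    {α : T} {n : ℕ} {I : Fin n → Set T} (hI : IsMaximalDecomposition L α I) {j : Fin n} {x y : T}
    (hx : x ∈ I j) (hy : y ∈ I j) (hxy : x < y) : ∃ w ∈ I j, w < x := by
  by_contra! hmin
  obtain ⟨g, hg, rfl⟩ := hconj x y ((hI.oneTyped j).2 x hx y hy)
  -- Each piece up to the `j`-th has a point below `g x`; for the `j`-th it is `x`. The values at `i
  -- > j` are never used.
  have hlow : ∀ i : Fin n, ∃ z ∈ I i, i ≤ j → z < g x := by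
    intro i
    rcases lt_trichotomy i j with h | rfl | h
    · obtain ⟨z, hz⟩ := (hI.oneTyped i).1.nonempty
      exact ⟨z, hz, fun _ => hI.lt i j h z hz _ hy⟩
    · exact ⟨x, hx, fun _ => hxy⟩
    · obtain ⟨z, hz⟩ := (hI.oneTyped i).1.nonempty
      exact ⟨z, hz, fun h' => absurd h h'.not_gt⟩
  choose z hz hzx using hlow
  have hsymm : ∀ i ≤ j, g.symm (z i) < x := fun i hi => by
    rw [← g.lt_iff_lt, g.apply_symm_apply]
    exact hzx i hi
  have hidx : ∀ i : Fin n, ∃ k : Fin n, i ≤ j → g.symm (z i) ∈ I k ∧ k < j := by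
    intro i
    by_cases hi : i ≤ j
    · obtain ⟨k, hk⟩ := hI.exists_mem ((hsymm i hi).trans (hI.lt_leaf hx))
      refine ⟨k, fun _ => ⟨hk, lt_of_le_of_ne (hI.le_of_le hk hx (hsymm i hi).le) ?_⟩⟩
      rintro rfl
      exact hmin _ hk (hsymm i hi)
    · exact ⟨i, fun h => absurd h hi⟩
  choose k hk using hidx
  have hcard : (Finset.Iio j).card < (Finset.Iic j).card := by simp
  -- The preimages under `g` of these points lie below the least element `x` of `I j`, hence in
  -- pieces of index less than `j`. There is one point too many, so two preimages share a piece, and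
  -- their images would be linked across distinct pieces.
  obtain ⟨i, hi, i', hi', hne, heq⟩ := Finset.exists_ne_map_eq_of_card_lt_of_maps_to hcard
    (f := k) (fun i hi => Finset.mem_Iio.2 (hk i (Finset.mem_Iic.1 hi)).2)
  rw [Finset.mem_Iic] at hi hi'
  refine hne ((hI.linked_iff hT (hz i) (hz i')).1 ?_)
  have h1 := (hk i hi).1
  rw [heq] at h1
  simpa using ((hI.oneTyped _).linked h1 (hk i' hi').1).image g hg

theorem IsMaximalDecomposition.exists_hasForm (hT : BranchesAreChains T)
    (hconj : ∀ x y : T, SameType L x y → ∃ g : T ≃o T,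
      (∀ x y, SameType L (g x) (g y) ↔ SameType L x y) ∧ g x = y)
    {α : T} {n : ℕ} {I : Fin n → Set T} (hI : IsMaximalDecomposition L α I) (j : Fin n) :
    ∃ F, HasForm α (I j) F := by
  have hsub := (hI.oneTyped j).1.isBranchInterval.subset_Iic
  by_cases hs : ∃ x, I j = {x}
  · obtain ⟨x, hx⟩ := hs
    exact ⟨.singleton, x, hsub (hx ▸ rfl), hx⟩
  obtain ⟨x, hx⟩ := (hI.oneTyped j).1.nonempty
  have hmin : ∀ z ∈ I j, ∃ w ∈ I j, w < z := by
    intro z hz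
    by_contra! hmin
    obtain ⟨y, hy, hyz⟩ : ∃ y ∈ I j, y ≠ z := by
      by_contra! h
      exact hs ⟨z, Set.eq_singleton_iff_unique_mem.2 ⟨hz, h⟩⟩
    rcases hT α z y (hsub hz) (hsub hy) with h | h
    · obtain ⟨w, hw, hwz⟩ := hI.exists_lt hT hconj hz hy (lt_of_le_of_ne h hyz.symm)
      exact hmin w hw hwz
    · exact hmin y hy (lt_of_le_of_ne h hyz)
  have hne : (I j).Nonempty := ⟨x, hx⟩
  by_cases hmax : ∃ c ∈ I j, ∀ z ∈ I j, z ≤ c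
  · obtain ⟨c, hc, hmax⟩ := hmax
    refine ⟨.openClosed, hne, hmin, ?_⟩
    rcases (hI.oneTyped j).1.isBranchInterval with ⟨a, ha, b, hb, h⟩ | ⟨b, hb, h⟩
    · have haI : a ∉ I j := by
        intro haI
        obtain ⟨w, hw, hwa⟩ := hmin a haI
        rcases h with h | h | h | h <;> rw [h] at hw
        exacts [hw.1.not_gt hwa, hw.1.not_gt hwa, hw.1.le.not_gt hwa, hw.1.le.not_gt hwa]
      have hlow : ∀ z ∈ I j, a < z := by
        intro z hz
        refine lt_of_le_of_ne ?_ fun h => haI (h ▸ hz)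
        rcases h with h | h | h | h <;> rw [h] at hz
        exacts [hz.1, hz.1, hz.1.le, hz.1.le]
      refine Or.inl ⟨a, ha, c, hsub hc, hlow c hc, Set.Subset.antisymm
        (fun z hz => ⟨hlow z hz, hmax z hz⟩) fun z hz => ?_⟩
      rcases h with h | h | h | h <;> rw [h] at hc ⊢
      exacts [⟨hz.1.le, hz.2.trans hc.2⟩, ⟨hz.1.le, hz.2.trans_lt hc.2⟩, ⟨hz.1, hz.2.trans hc.2⟩,
        ⟨hz.1, hz.2.trans_lt hc.2⟩]
    · refine Or.inr ⟨c, hsub hc, Set.Subset.antisymm hmax fun z hz => ?_⟩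
      rcases h with h | h <;> rw [h] at hc ⊢
      exacts [le_trans hz hc, lt_of_le_of_lt hz hc]
  · push Not at hmax
    have hmax' : ∀ z ∈ I j, ∃ w ∈ I j, z < w := by
      intro z hz
      obtain ⟨w, hw, hwz⟩ := hmax z hz
      refine ⟨w, hw, lt_of_le_not_ge ((hT α z w (hsub hz) (hsub hw)).resolve_right hwz) hwz⟩
    refine ⟨.openOpen, hne, hmin, hmax', ?_⟩
    rcases (hI.oneTyped j).1.isBranchInterval with ⟨a, ha, b, hb, h⟩ | ⟨b, hb, h⟩
    · have haI : a ∉ I j := by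
        intro haI
        obtain ⟨w, hw, hwa⟩ := hmin a haI
        rcases h with h | h | h | h <;> rw [h] at hw
        exacts [hw.1.not_gt hwa, hw.1.not_gt hwa, hw.1.le.not_gt hwa, hw.1.le.not_gt hwa]
      have hbI : b ∉ I j := by
        intro hbI
        obtain ⟨w, hw, hwa⟩ := hmax' b hbI
        rcases h with h | h | h | h <;> rw [h] at hw
        exacts [hw.2.not_gt hwa, hw.2.le.not_gt hwa, hw.2.not_gt hwa, hw.2.le.not_gt hwa]
      have hIoo : I j = Set.Ioo a b := by
        refine Set.Subset.antisymm (fun z hz => ?_) fun z hz => ?_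
        · refine ⟨lt_of_le_of_ne ?_ fun h => haI (h ▸ hz), lt_of_le_of_ne ?_ fun h => hbI (h ▸ hz)⟩
          · rcases h with h | h | h | h <;> rw [h] at hz
            exacts [hz.1, hz.1, hz.1.le, hz.1.le]
          · rcases h with h | h | h | h <;> rw [h] at hz
            exacts [hz.2, hz.2.le, hz.2, hz.2.le]
        · rcases h with h | h | h | h <;> rw [h]
          exacts [⟨hz.1.le, hz.2.le⟩, ⟨hz.1.le, hz.2⟩, ⟨hz.1, hz.2.le⟩, hz]
      have hx' := hx
      rw [hIoo] at hx'
      exact Or.inl ⟨a, ha, b, hb, hx'.1.trans hx'.2, hIoo⟩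
    · refine Or.inr ⟨b, hb, ?_⟩
      rcases h with h | h
      · exfalso
        have hbI : b ∈ I j := h ▸ Set.mem_Iic.2 le_rfl
        obtain ⟨w, hw, hbw⟩ := hmax' b hbI
        rw [h] at hw
        exact (Set.mem_Iic.1 hw).not_gt hbw
      · exact h

/-- A tree whose leaves are conjugate, and where elements of the same type are conjugate, has a
uniform decomposition as soon as one branch has a maximal decomposition. -/
theorem hasUniformDecomposition_of_conjugate (hT : BranchesAreChains T)
    (hconj : ∀ x y : T, SameType L x y → ∃ g : T ≃o T,
      (∀ x y, SameType L (g x) (g y) ↔ SameType L x y) ∧ g x = y)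
    {α₀ : T} (hleaf : ∀ α : T, IsMax α → ∃ g : T ≃o T, (∀ x, SameType L (g x) x) ∧ g α₀ = α)
    (hlt : ∃ x, x < α₀) {n : ℕ} {I : Fin n → Set T} (hI : IsMaximalDecomposition L α₀ I) :
    HasUniformDecomposition L T := by
  have hpos : 1 ≤ n := by
    obtain ⟨x, hx⟩ := hlt
    obtain ⟨j, -⟩ := hI.exists_mem hx
    exact j.pos
  choose g hg hgα using fun α : {α : T // IsMax α} => hleaf α.1 α.2
  have hg' : ∀ α x y, SameType L (g α x) (g α y) ↔ SameType L x y := fun α x y =>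
    ⟨fun h => (hg α x).symm.trans (h.trans (hg α y)),
      fun h => (hg α x).trans (h.trans (hg α y).symm)⟩
  have hmax : ∀ α : {α : T // IsMax α}, IsMaximalDecomposition L α.1 fun j => g α '' I j := by
    intro α
    have := hI.image (g α) (hg' α)
    rwa [hgα] at this
  choose form hform using hI.exists_hasForm hT hconj
  refine ⟨n, hpos, fun α j => g α '' I j, hmax, fun α m J hJ => (hmax α).unique hT hJ,
    ⟨form, fun α j => ?_⟩, ?_⟩
  · have := (hform j).image (g α)
    rwa [hgα] at this
  · rintro α β j _ ⟨x, hx, rfl⟩ _ ⟨y, hy, rfl⟩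
    exact (hg α x).trans (((hI.oneTyped j).2 x hx y hy).trans (hg β y).symm)

end Existence

section Types

open FirstOrder.Language

variable {T : Type*} {L : Language} [L.Structure T]

/-! ### Types in structures with finitely many types -/

theorem FirstOrder.Language.Equiv.sameType (g : T ≃[L] T) (x : T) : SameType L (g x) x :=
  fun φ => StrongHomClass.realize_formula g φ (v := fun _ => x)

theorem FirstOrder.Language.Equiv.sameType_iff (g : T ≃[L] T) (x y : T) :
    SameType L (g x) (g y) ↔ SameType L x y :=
  ⟨fun h => (g.sameType x).symm.trans (h.trans (g.sameType y)),
    fun h => (g.sameType x).trans (h.trans (g.sameType y).symm)⟩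

theorem SameType.exists_equiv [Countable T] (hfin : HasFinitelyManyTypes L T) {x y : T}
    (h : SameType L x y) : ∃ g : T ≃[L] T, g x = y := by
  obtain ⟨g, hg⟩ := hfin.isAtomicStructure.exists_equiv (a := fun _ : Fin 1 => x)
    (b := fun _ => y) h
  exact ⟨g, congrFun hg 0⟩

/-- The set of elements of the same type as `x` is `∅`-definable when there are finitely many
types. -/
theorem definable₁_sameType (hfin : HasFinitelyManyTypes L T) (x : T) :
    (∅ : Set T).Definable₁ L {y | SameType L x y} := by
  obtain ⟨D, hD, hxD⟩ := hfin.isAtomicStructure 1 fun _ => x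
  unfold Set.Definable₁
  convert hD.definable using 1
  ext v
  have hv : v = fun _ => v 0 := by
    ext i
    rw [Subsingleton.elim i 0]
  constructor
  · intro h
    rw [hv]
    exact (realize_iff_iff_mem_definable.1 h D hD.definable).1 hxD
  · intro hvD
    refine realize_iff_iff_mem_definable.2 fun E hE => ?_
    rw [← hv]
    exact ⟨fun h => hD.subset_of_mem hE hxD h hvD, fun h => hD.subset_of_mem hE hvD h hxD⟩

theorem finite_range_sameType (hfin : HasFinitelyManyTypes L T) :
    (Set.range fun x : T => {y | SameType L x y}).Finite := by
  refine Set.Finite.of_finite_image (f := fun S : Set T => {v : Fin 1 → T | v 0 ∈ S})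
    ((hfin 1).subset ?_) ?_
  · rintro _ ⟨_, ⟨x, rfl⟩, rfl⟩
    exact definable₁_sameType hfin x
  · intro S _ S' _ h
    ext x
    exact Set.ext_iff.1 h fun _ => x

end Types

section OMinimal

open FirstOrder.Language

variable {T : Type*} [PartialOrder T] {L : Language} [L.Structure T]

/-! ### Order-definable subsets of branches -/

theorem definable₁_Iio (hlt : (∅ : Set T).Definable L {v : Fin 2 → T | v 0 < v 1}) (α : T) :
    (Set.univ : Set T).Definable₁ L (Set.Iio α) := by
  have h1 : (Set.univ : Set T).Definable L {v : Fin 2 → T | v 1 = α} :=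
    (Set.Definable.singleton_of_mem L (Set.mem_univ α)).preimage_comp fun _ : Fin 1 => (1 : Fin 2)
  have h2 := (((hlt.mono (Set.empty_subset _)).inter h1).image_comp fun _ : Fin 1 => (0 : Fin 2))
  unfold Set.Definable₁
  convert h2 using 1
  ext v
  constructor
  · intro hv
    exact ⟨![v 0, α], ⟨hv, rfl⟩, by ext i; fin_cases i; rfl⟩
  · rintro ⟨w, ⟨hw, hwα⟩, rfl⟩
    exact lt_of_lt_of_eq hw hwα

theorem definable_covBy (hlt : (∅ : Set T).Definable L {v : Fin 2 → T | v 0 < v 1}) :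
    (∅ : Set T).Definable L {v : Fin 2 → T | v 0 ⋖ v 1} := by
  have h1 : (∅ : Set T).Definable L {v : Fin 3 → T | v 0 < v 1 ∧ v 1 < v 2} :=
    (hlt.preimage_comp ![(0 : Fin 3), 1]).inter (hlt.preimage_comp ![(1 : Fin 3), 2])
  convert hlt.sdiff (h1.image_comp ![(0 : Fin 3), 2]) using 1
  ext v
  constructor
  · intro hv
    refine ⟨hv.lt, ?_⟩
    rintro ⟨w, ⟨hw1, hw2⟩, rfl⟩
    exact hv.2 hw1 hw2
  · rintro ⟨hv, hno⟩
    refine ⟨hv, fun c h1 h2 => hno ⟨![v 0, c, v 1], ⟨h1, h2⟩, ?_⟩⟩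
    ext i
    fin_cases i <;> rfl

theorem definable₁_exists_covBy (hlt : (∅ : Set T).Definable L {v : Fin 2 → T | v 0 < v 1})
    (α : T) : (Set.univ : Set T).Definable₁ L {x | ∃ y ≤ α, x ⋖ y} := by
  have h1 : (Set.univ : Set T).Definable L {v : Fin 2 → T | v 1 ≤ α} := by
    convert ((definable₁_Iio hlt α).union
      (Set.Definable.singleton_of_mem L (Set.mem_univ α))).preimage_comp
        fun _ : Fin 1 => (1 : Fin 2) using 1
    ext v
    exact le_iff_lt_or_eq
  have h2 := (((definable_covBy hlt).mono (Set.empty_subset _)).inter h1).image_comp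
    fun _ : Fin 1 => (0 : Fin 2)
  unfold Set.Definable₁
  convert h2 using 1
  ext v
  constructor
  · rintro ⟨y, hy, hvy⟩
    exact ⟨![v 0, y], ⟨hvy, hy⟩, by ext i; fin_cases i; rfl⟩
  · rintro ⟨w, ⟨hw, hwα⟩, rfl⟩
    exact ⟨w 1, hwα, hw⟩

theorem FirstOrder.Language.Equiv.lt_iff_lt_of_definable
    (hlt : (∅ : Set T).Definable L {v : Fin 2 → T | v 0 < v 1}) (g : T ≃[L] T) (x y : T) :
    g x < g y ↔ x < y := by
  simpa using g.mem_iff_of_definable hlt ![x, y]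

/-- Automorphisms preserve the order when it is `∅`-definable. -/
def FirstOrder.Language.Equiv.toOrderIso
    (hlt : (∅ : Set T).Definable L {v : Fin 2 → T | v 0 < v 1}) (g : T ≃[L] T) : T ≃o T where
  toEquiv := g.toEquiv
  map_rel_iff' {x y} := by
    change g x ≤ g y ↔ x ≤ y
    rw [le_iff_lt_or_eq, le_iff_lt_or_eq, g.lt_iff_lt_of_definable hlt, g.injective.eq_iff]

/-! ### Finiteness of the set of elements with a successor in a branch -/

/-- Pairs fall into finitely many orbits, and the size of `Ioc` is invariant. Infinite intervals
merely contribute the value `0`. -/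
theorem finite_range_ncard_Ioc [Countable T] (hfin : HasFinitelyManyTypes L T)
    (hlt : (∅ : Set T).Definable L {v : Fin 2 → T | v 0 < v 1}) :
    (Set.range fun p : T × T => (Set.Ioc p.1 p.2).ncard).Finite := by
  obtain ⟨A, hA, hor⟩ := hfin.exists_orbits 2
  refine (hA.image fun v => (Set.Ioc (v 0) (v 1)).ncard).subset ?_
  rintro _ ⟨⟨x, y⟩, rfl⟩
  obtain ⟨g, hg⟩ := hor ![x, y]
  refine ⟨_, hg, ?_⟩
  have := (g.toOrderIso hlt).image_Ioc x y
  have h2 := Set.ncard_image_of_injective (Set.Ioc x y) (g.toOrderIso hlt).injective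
  rw [this] at h2
  exact h2

/-- Climbing by successors from the lowest of `N + 2` points of `I` produces intervals `Ioc` of
every size up to `N + 1`, beyond the bound `N`. -/
theorem IsBranchInterval.finite_of_forall_covBy (hT : BranchesAreChains T) {α : T}
    (hbd : (Set.range fun p : T × T => (Set.Ioc p.1 p.2).ncard).Finite) {I : Set T}
    (hI : IsBranchInterval α I) (hsucc : ∀ x ∈ I, ∃ y ≤ α, x ⋖ y) : I.Finite := by
  by_contra hinf
  obtain ⟨N, hN⟩ := hbd.bddAbove
  have hle : ∀ x y : T, (Set.Ioc x y).ncard ≤ N := fun x y => hN ⟨(x, y), rfl⟩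
  obtain ⟨R, hRI, hRfin, hRcard⟩ := Set.Infinite.exists_subset_ncard_eq hinf (N + 2)
  have hsub := hI.subset_Iic
  obtain ⟨m, f, hf, hfR⟩ := exists_strictMono_range_eq hT hRfin (hRI.trans hsub)
  obtain rfl : m = N + 2 := by
    rw [← hRcard, ← hfR, ← Set.image_univ, Set.ncard_image_of_injective _ hf.injective]
    simp
  have hfI : ∀ i, f i ∈ I := fun i => hRI (hfR ▸ ⟨i, rfl⟩)
  -- The `k`-th successor stays below the `k`-th chosen point, hence in `I`. Finiteness is carried
  -- along because `ncard` is `0` on infinite sets.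
  have hstep : ∀ k : ℕ, ∀ hk : k < N + 2, ∃ y ∈ I, f 0 ≤ y ∧ y ≤ f ⟨k, hk⟩ ∧
      (Set.Ioc (f 0) y).Finite ∧ (Set.Ioc (f 0) y).ncard = k := by
    intro k
    induction k with
    | zero => exact fun hk => ⟨f 0, hfI 0, le_rfl, le_rfl, by simp, by simp⟩
    | succ k ih =>
      intro hk
      obtain ⟨y, hyI, h0y, hyk, hyfin, hycard⟩ := ih (by omega)
      obtain ⟨z, hz, hyz⟩ := hsucc y hyI
      have hyk' : y < f ⟨k + 1, hk⟩ := hyk.trans_lt (hf (Fin.mk_lt_mk.2 (Nat.lt_succ_self k)))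
      have hzk : z ≤ f ⟨k + 1, hk⟩ := by
        rcases hT α z (f ⟨k + 1, hk⟩) hz (hsub (hfI _)) with h | h
        · exact h
        · rcases h.eq_or_lt with h | h
          · exact h.ge
          · exact absurd h (hyz.2 hyk')
      have hset : Set.Ioc (f 0) z = insert z (Set.Ioc (f 0) y) := by
        ext w
        constructor
        · rintro ⟨h0w, hwz⟩
          rcases hwz.eq_or_lt with rfl | hwz
          · exact Or.inl rfl
          · refine Or.inr ⟨h0w, ?_⟩
            rcases hT z w y hwz.le hyz.le with h | h
            · exact h
            · rcases h.eq_or_lt with h | h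
              exacts [h.ge, absurd hwz (hyz.2 h)]
        · rintro (rfl | hw)
          exacts [⟨h0y.trans_lt hyz.lt, le_rfl⟩, ⟨hw.1, hw.2.trans hyz.le⟩]
      refine ⟨z, hI.ordConnected.out hyI (hfI _) ⟨hyz.le, hzk⟩, h0y.trans hyz.le, hzk, ?_, ?_⟩
      · rw [hset]
        exact hyfin.insert z
      · rw [hset, Set.ncard_insert_of_notMem (fun h => h.2.not_gt hyz.lt) hyfin, hycard]
  obtain ⟨y, -, -, -, -, hy⟩ := hstep (N + 1) (by omega)
  have := hle (f 0) y
  omega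

/-- In an o-minimal tree with finitely many types, the branches are finite unions of intervals of
linked elements. -/
theorem exists_finite_cover_linked [Countable T] (hT : BranchesAreChains T)
    (hfin : HasFinitelyManyTypes L T)
    (hlt : (∅ : Set T).Definable L {v : Fin 2 → T | v 0 < v 1})
    (homin : BranchesOMinimal L T) {α : T} (hα : IsMax α) :
    ∃ F : Set (Set T), F.Finite ∧ (∀ I ∈ F, IsBranchInterval α I) ∧
      (∀ I ∈ F, ∀ x ∈ I, ∀ y ∈ I, Linked L x y) ∧ ⋃₀ F = Set.Iio α := by
  -- Elements with a successor in the branch, the only obstruction to density.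
  let D : Set T := {x | ∃ y ≤ α, x ⋖ y}
  have hDα : D ⊆ Set.Iio α := fun x ⟨y, hy, hxy⟩ => hxy.lt.trans_le hy
  have hDfin : D.Finite := by
    obtain ⟨F, hF, hFI, hDF⟩ := homin α hα D (hDα.trans Set.Iio_subset_Iic_self)
      (definable₁_exists_covBy hlt α)
    rw [hDF]
    refine hF.sUnion fun I hI => (hFI I hI).finite_of_forall_covBy hT
      (finite_range_ncard_Ioc hfin hlt) fun x hx => ?_
    have : x ∈ D := hDF ▸ ⟨I, hI, hx⟩
    exact this
  have hpart : ∀ x : T, ∃ F : Set (Set T), F.Finite ∧ (∀ I ∈ F, IsBranchInterval α I) ∧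
      ({y | SameType L x y} ∩ Set.Iio α) \ D = ⋃₀ F := by
    intro x
    refine homin α hα _ (fun y hy => hy.1.2.le) ?_
    exact (((definable₁_sameType hfin x).mono (Set.empty_subset _)).inter
      (definable₁_Iio hlt α)).sdiff (definable₁_exists_covBy hlt α)
  choose G hG hGI hGU using hpart
  have := finite_range_sameType hfin (L := L) (T := T)
  let t : T → Set T := fun x => {y | SameType L x y}
  have : Finite (Set.range t) := this
  let s : Set.range t → T := Set.rangeSplitting t
  have hs : ∀ x : T, SameType L (s ⟨t x, x, rfl⟩) x := fun x => by
    have h1 : t (s ⟨t x, x, rfl⟩) = t x := Set.apply_rangeSplitting t ⟨t x, x, rfl⟩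
    have h2 : x ∈ t x := SameType.refl x
    rwa [← h1] at h2
  refine ⟨(⋃ K, G (s K)) ∪ (fun x => {x}) '' D, (Set.finite_iUnion fun K => hG _).union
    (hDfin.image _), ?_, ?_, ?_⟩
  · rintro I (hI | ⟨x, hx, rfl⟩)
    · obtain ⟨K, hK⟩ := Set.mem_iUnion.1 hI
      exact hGI _ I hK
    · exact isBranchInterval_singleton (hDα hx).le
  · rintro I (hI | ⟨x, hx, rfl⟩)
    · obtain ⟨K, hK⟩ := Set.mem_iUnion.1 hI
      have hmem : ∀ z ∈ I, z ∈ ({y | SameType L (s K) y} ∩ Set.Iio α) \ D := fun z hz =>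
        hGU (s K) ▸ ⟨I, hK, hz⟩
      intro x hx y hy
      refine IsDenseOneTyped.linked (S := I) ⟨fun u hu v hv =>
        (SameType.symm (hmem u hu).1.1).trans (hmem v hv).1.1, fun u hu v hv huv => ?_⟩
        (hGI _ I hK).ordConnected hx hy
      -- With nothing of `I` strictly between `u` and `v`, convexity makes `v` a successor of `u` in
      -- the branch, so `u` would be in `D`.
      by_contra! hno
      refine (hmem u hu).2 ⟨v, (le_of_lt (hmem v hv).1.2), huv, fun c huc hcv => ?_⟩
      exact hno c ((hGI _ I hK).ordConnected.out hu hv ⟨huc.le, hcv.le⟩) huc hcv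
    · rintro y rfl z rfl
      exact Linked.refl _
  · ext x
    constructor
    · rintro ⟨I, hI | ⟨y, hy, rfl⟩, hx⟩
      · obtain ⟨K, hK⟩ := Set.mem_iUnion.1 hI
        have : x ∈ ({y | SameType L (s K) y} ∩ Set.Iio α) \ D := hGU (s K) ▸ ⟨I, hK, hx⟩
        exact this.1.2
      · obtain rfl : x = y := hx
        exact hDα hy
    · intro hx
      by_cases hxD : x ∈ D
      · exact ⟨{x}, Or.inr ⟨x, hxD, rfl⟩, rfl⟩
      · have : x ∈ ⋃₀ G (s ⟨t x, x, rfl⟩) := hGU _ ▸ ⟨⟨hs x, hx⟩, hxD⟩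
        obtain ⟨I, hI, hxI⟩ := this
        exact ⟨I, Or.inl (Set.mem_iUnion.2 ⟨_, hI⟩), hxI⟩

/-- A countable o-minimal tree with finitely many types of tuples and conjugate leaves has a
uniform decomposition. -/
theorem hasUniformDecomposition_of_oMinimal [Countable T] (hT : BranchesAreChains T)
    (hfin : HasFinitelyManyTypes L T)
    (hlt : (∅ : Set T).Definable L {v : Fin 2 → T | v 0 < v 1})
    (homin : BranchesOMinimal L T) {α₀ : T} (hα₀ : IsMax α₀) (hx : ∃ x, x < α₀)
    (hleaf : ∀ α : T, IsMax α → ∃ g : T ≃[L] T, g α₀ = α) : HasUniformDecomposition L T := by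
  obtain ⟨F, hF, hFI, hlink, hcov⟩ := exists_finite_cover_linked hT hfin hlt homin hα₀
  obtain ⟨n, I, hI⟩ := exists_isMaximalDecomposition hT hF hFI hlink hcov
  refine hasUniformDecomposition_of_conjugate hT (fun x y h => ?_) (fun α hα => ?_) hx hI
  · obtain ⟨g, hg⟩ := h.exists_equiv hfin
    exact ⟨g.toOrderIso hlt, g.sameType_iff, hg⟩
  · obtain ⟨g, hg⟩ := hleaf α hα
    exact ⟨g.toOrderIso hlt, g.sameType, hg⟩

end OMinimal

/-! ### The canonical tree -/

namespace CanonicalTree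

open FirstOrder.Language

variable {M : Type*} {C : M → M → M → Prop} {h : IsCRelation C}

theorem branchesAreChains : BranchesAreChains (CanonicalTree h) := by
  intro z x y hx hy
  obtain ⟨a, b, rfl⟩ := exists_mk z
  obtain ⟨c, d, rfl⟩ := exists_mk x
  obtain ⟨e, f, rfl⟩ := exists_mk y
  have hs := h.symm
  have ha := h.asymm
  have ht := h.trans
  rw [mk_le_mk] at *
  rw [mk_le_mk]
  grind

theorem mk_le_mk_self (a b : M) : mk h a b ≤ mk h a a :=
  mk_le_mk.2 ⟨fun H => h.asymm _ _ _ H H, fun H => h.asymm _ _ _ H H⟩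

theorem isMax_mk_self (a : M) : IsMax (mk h a a) := by
  intro x hx
  obtain ⟨b, c, rfl⟩ := exists_mk x
  obtain ⟨h1, h2⟩ := mk_le_mk.1 hx
  obtain rfl : b = a := by
    by_contra hne
    exact h1 (h.nontriv _ _ hne)
  obtain rfl : c = b := by
    by_contra hne
    exact h2 (h.nontriv _ _ hne)
  exact le_rfl

theorem exists_eq_mk_self_of_isMax {x : CanonicalTree h} (hx : IsMax x) : ∃ a, x = mk h a a := by
  obtain ⟨a, b, rfl⟩ := exists_mk x
  exact ⟨a, le_antisymm (mk_le_mk_self a b) (hx (mk_le_mk_self a b))⟩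

theorem exists_lt_mk_self [Nontrivial M] (a : M) : ∃ x, x < mk h a a := by
  obtain ⟨b, hb⟩ := exists_ne a
  refine ⟨mk h a b, lt_of_le_not_ge (mk_le_mk_self a b) fun hle => ?_⟩
  exact (mk_le_mk.1 hle).2 (h.nontriv _ _ hb)

instance [Countable M] : Countable (CanonicalTree h) :=
  Function.Surjective.countable (f := fun p : M × M => mk h p.1 p.2) fun x => by
    obtain ⟨a, b, rfl⟩ := exists_mk x
    exact ⟨(a, b), rfl⟩

/-! ### The action of automorphisms of `M` on the canonical tree -/

theorem exists_mk_map_eq (g : M ≃ M) (hg : ∀ a b c, C (g a) (g b) (g c) ↔ C a b c)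
    (x : CanonicalTree h) : ∃ y : CanonicalTree h, ∀ a b, x = mk h a b → y = mk h (g a) (g b) := by
  obtain ⟨a, b, rfl⟩ := exists_mk x
  refine ⟨mk h (g a) (g b), fun c d hcd => ?_⟩
  have h1 := mk_le_mk.1 hcd.le
  have h2 := mk_le_mk.1 hcd.ge
  exact le_antisymm (mk_le_mk.2 (by simpa only [hg] using h1))
    (mk_le_mk.2 (by simpa only [hg] using h2))

/-- A permutation preserving `C` induces an automorphism of the ordered set `T`. -/
theorem exists_orderIso (h : IsCRelation C) (g : M ≃ M)
    (hg : ∀ a b c, C (g a) (g b) (g c) ↔ C a b c) :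
    ∃ G : CanonicalTree h ≃o CanonicalTree h, ∀ a b, G (mk h a b) = mk h (g a) (g b) := by
  have hg' : ∀ a b c, C (g.symm a) (g.symm b) (g.symm c) ↔ C a b c := fun a b c => by
    rw [← hg]
    simp
  choose G hG using exists_mk_map_eq (h := h) g hg
  choose G' hG' using exists_mk_map_eq (h := h) g.symm hg'
  refine ⟨⟨⟨G, G', fun x => ?_, fun x => ?_⟩, ?_⟩, fun a b => hG _ a b rfl⟩
  · obtain ⟨a, b, rfl⟩ := exists_mk x
    rw [hG _ a b rfl, hG' _ _ _ rfl]
    simp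
  · obtain ⟨a, b, rfl⟩ := exists_mk x
    rw [hG' _ a b rfl, hG _ _ _ rfl]
    simp
  · intro x y
    obtain ⟨a, b, rfl⟩ := exists_mk x
    obtain ⟨c, d, rfl⟩ := exists_mk y
    change G _ ≤ G _ ↔ _
    rw [hG _ a b rfl, hG _ c d rfl, mk_le_mk, mk_le_mk, hg, hg]

theorem map_meet (G : CanonicalTree h ≃o CanonicalTree h) (x y : CanonicalTree h) :
    G (meet x y) = meet (G x) (G y) := by
  refine IsGLB.unique (s := {G x, G y}) ?_ (isGLB_meet _ _)
  have := (isGLB_meet x y)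
  rw [← G.isGLB_image'] at this
  simpa [Set.image_pair] using this

/-- Order automorphisms of the canonical tree are automorphisms for `{<, ∧, L}`. -/
noncomputable def treeLanguageEquiv (G : CanonicalTree h ≃o CanonicalTree h) :
    CanonicalTree h ≃[treeLanguage] CanonicalTree h where
  toEquiv := G.toEquiv
  map_fun' := by
    intro n f v
    cases f
    exact map_meet G (v 0) (v 1)
  map_rel' := by
    intro n r v
    cases r
    · exact G.lt_iff_lt
    · exact G.isMax_apply

variable (L : Language) [L.Structure M]

/-- Automorphisms of `M` preserve the induced structure on the canonical tree. -/
def inducedLanguageEquiv (g : M ≃[L] M) (G : CanonicalTree h ≃ CanonicalTree h)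
    (hG : ∀ a b, G (mk h a b) = mk h (g a) (g b)) :
    CanonicalTree h ≃[inducedLanguage L h] CanonicalTree h where
  toEquiv := G
  map_fun' := fun f => Empty.elim f
  map_rel' := by
    intro n S v
    choose a b hab using fun i => exists_mk (v i)
    have := g.mem_iff_of_definable S.2 fun p => ![a p.1, b p.1] p.2
    simp only [Set.mem_ofPred_eq, Function.comp_apply, Matrix.cons_val_zero,
      Matrix.cons_val_one] at this
    have hv : v = fun i => mk h (a i) (b i) := funext hab
    subst hv
    change (fun i => G (mk h (a i) (b i))) ∈ S.1 ↔ (fun i => mk h (a i) (b i)) ∈ S.1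
    simp only [hG]
    exact this

/-- A `k`-tuple of `T` is represented by a `2k`-tuple of `M`, so finiteness of the number of orbits
passes to `T` for any structure preserved by the action. -/
theorem hasFinitelyManyTypes (hfin : HasFinitelyManyTypes L M) [Countable M]
    (K : Language) [K.Structure (CanonicalTree h)]
    (hext : ∀ g : M ≃[L] M, ∃ G : CanonicalTree h ≃[K] CanonicalTree h,
      ∀ a b, G (mk h a b) = mk h (g a) (g b)) : HasFinitelyManyTypes K (CanonicalTree h) := by
  refine hasFinitelyManyTypes_of_orbits fun k => ?_
  obtain ⟨A, hA, hor⟩ := hfin.exists_orbits (k + k)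
  refine ⟨(fun w i => mk h (w (Fin.castAdd k i)) (w (Fin.natAdd k i))) '' A, hA.image _,
    fun v => ?_⟩
  choose a b hab using fun i => exists_mk (v i)
  obtain ⟨g, hg⟩ := hor (Fin.append a b)
  obtain ⟨G, hG⟩ := hext g
  refine ⟨G, _, hg, ?_⟩
  ext i
  change mk h (g (Fin.append a b (Fin.castAdd k i))) (g (Fin.append a b (Fin.natAdd k i))) = G (v i)
  rw [Fin.append_left, Fin.append_right, hab, hG]

/-- The language `K` stays arbitrary to serve both structures on `T`: only the action of
automorphisms and the definability of the order matter. Leaves are the classes of pairs `(a, a)`, so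
indiscernibility of `M` makes them conjugate. -/
theorem hasUniformDecomposition [Countable M] [Nontrivial M] (hind : Indiscernible L M)
    (hfin : HasFinitelyManyTypes L M) (K : Language) [K.Structure (CanonicalTree h)]
    (hext : ∀ g : M ≃[L] M, ∃ G : CanonicalTree h ≃[K] CanonicalTree h,
      ∀ a b, G (mk h a b) = mk h (g a) (g b))
    (hlt : (∅ : Set (CanonicalTree h)).Definable K {v : Fin 2 → CanonicalTree h | v 0 < v 1})
    (homin : BranchesOMinimal K (CanonicalTree h)) :
    HasUniformDecomposition K (CanonicalTree h) := by
  obtain ⟨a⟩ : Nonempty M := inferInstance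
  refine hasUniformDecomposition_of_oMinimal branchesAreChains
    (hasFinitelyManyTypes L hfin K hext) hlt homin (isMax_mk_self a) (exists_lt_mk_self a)
    fun α hα => ?_
  obtain ⟨b, rfl⟩ := exists_eq_mk_self_of_isMax hα
  obtain ⟨g, hg⟩ := SameType.exists_equiv hfin (hind a b)
  obtain ⟨G, hG⟩ := hext g
  exact ⟨G, by rw [hG, hg]⟩

theorem definable_lt_treeLanguage :
    (∅ : Set (CanonicalTree h)).Definable treeLanguage
      {v : Fin 2 → CanonicalTree h | v 0 < v 1} :=
  definable_relMap (L := treeLanguage) (n := 2) TreeRelations.lt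

/-- The order of `T` is expressed by `C` on representatives, so it is itself a symbol of the induced
language. -/
theorem definable_lt_inducedLanguage
    (hC : ∀ {ι : Type} (i j k : ι), (∅ : Set M).Definable L {v : ι → M | C (v i) (v j) (v k)}) :
    (∅ : Set (CanonicalTree h)).Definable (inducedLanguage L h)
      {v : Fin 2 → CanonicalTree h | v 0 < v 1} := by
  have hle : ∀ i j : Fin 2, (∅ : Set M).Definable L {v : Fin 2 × Fin 2 → M |
      mk h (v (i, 0)) (v (i, 1)) ≤ mk h (v (j, 0)) (v (j, 1))} := fun i j =>
    (hC (j, 0) (i, 0) (i, 1)).compl.inter (hC (j, 1) (i, 0) (i, 1)).compl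
  have hS : DefinableIn L h {v : Fin 2 → CanonicalTree h | v 0 < v 1} := by
    unfold DefinableIn
    convert (hle 0 1).sdiff (hle 1 0) using 1
    ext v
    exact lt_iff_le_not_ge (a := mk h (v (0, 0)) (v (0, 1))) (b := mk h (v (1, 0)) (v (1, 1)))
  exact definable_relMap (L := inducedLanguage L h) (n := 2) ⟨_, hS⟩

end CanonicalTree

/-- `M` is a `C`-structure in a countable language with symbol `C`. The result is stated both for
its canonical tree as a structure in the language `{<, ∧, L}`, and for its canonical tree with all
the structure induced by `M`. -/
theorem theorem3 (L : Language) [Countable L.Symbols] (C : L.Relations 3)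
    (M : Type*) [L.Structure M] [Countable M] [Nontrivial M]
    (hC : IsCRelation (fun x y z : M => Language.Structure.RelMap C ![x, y, z]))
    (hind : Indiscernible L M)
    (hcat : Cardinal.aleph0.Categorical (L.completeTheory M)) :
    (BranchesOMinimal treeLanguage (CanonicalTree hC) →
      HasUniformDecomposition treeLanguage (CanonicalTree hC)) ∧
    (BranchesOMinimal (inducedLanguage L hC) (CanonicalTree hC) →
      HasUniformDecomposition (inducedLanguage L hC) (CanonicalTree hC)) := by
  have hfin := Language.hasFinitelyManyTypes_of_categorical hcat
  have hext : ∀ g : M ≃[L] M, ∃ G : CanonicalTree hC ≃o CanonicalTree hC,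
      ∀ a b, G (CanonicalTree.mk hC a b) = CanonicalTree.mk hC (g a) (g b) := fun g =>
    CanonicalTree.exists_orderIso hC g.toEquiv fun a b c => by
      have := g.map_rel C ![a, b, c]
      convert this using 2
      ext i
      fin_cases i <;> rfl
  constructor
  · refine CanonicalTree.hasUniformDecomposition L hind hfin treeLanguage (fun g => ?_)
      CanonicalTree.definable_lt_treeLanguage
    obtain ⟨G, hG⟩ := hext g
    exact ⟨CanonicalTree.treeLanguageEquiv G, hG⟩
  · refine CanonicalTree.hasUniformDecomposition L hind hfin (inducedLanguage L hC) (fun g => ?_)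
      (CanonicalTree.definable_lt_inducedLanguage L fun {ι} i j k => ?_)
    · obtain ⟨G, hG⟩ := hext g
      exact ⟨CanonicalTree.inducedLanguageEquiv L g G.toEquiv hG, hG⟩
    · convert (Language.definable_relMap C).preimage_comp ![i, j, k] using 1
      ext v
      refine iff_of_eq (congrArg (Language.Structure.RelMap C) ?_)
      ext l
      fin_cases l <;> rfl
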